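/- All graphs are simple, locally finite and connected. A $d$-sphere packing is a family $(B_v)_{v\in V}$ of closed balls in $\mathbb R^d$ of radii $r_v>0$ with pairwise disjoint interiors; its tangency graph has vertex set $V$ and an edge between $u\neq v$ iff $B_u$ and $B_v$ are tangent. A graph is $M$-uniform in dimension $d$ if it is the tangency graph of a $d$-sphere packing in which $r_u/r_v\le M$ for all tangent balls $B_u,B_v$. For a graph $G=(V,E)$ and $v\in V$, let $\Gamma(v)$ be the set of semi-infinite (self-avoiding) paths in $G$ started from $v$. For $m:V\to[0,\infty)$ put $\mathrm{Length}_m(\gamma)=\sum_{u\in\gamma}m(u)$ and $\|m\|_d^d=\sum_{u\in V}m(u)^d$. The graph $G$ is $d$-parabolic if, for every vertex $v$, the $d$-vertex extremal length $$\sup_{m}\ \inf_{\gamma\in\Gamma(v)}\frac{\mathrm{Length}_m(\gamma)^d}{\|m\|_d^d}$$ is infinite, where the supremum is over all $m\ne 0$ with $\|m\|_d<\infty$ and $\inf\varnothing=\infty$. The space of isomorphism classes of rooted graphs is equipped with the distance $\Delta((G,o),(G',o'))=(1+\sup\{k: \mathrm{Ball}_G(o,k)\cong \mathrm{Ball}_{G'}(o',k)\})^{-1}$,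 where the balls are the closed balls for the graph distance, considered as rooted graphs, and with its Borel $\sigma$-algebra. A random rooted graph $(G,o)$ is a random element of this space; it is unbiased if $G$ is almost surely finite and, conditionally on the (unrooted) graph $G$, the root $o$ is uniform over the vertices of $G$. **Theorem 1.** Let $M\ge 0$ and let $d\ge 2$ be an integer. Let $(G_n,o_n)_{n\ge0}$ be a sequence of unbiased random rooted graphs such that, almost surely, for all $n\ge 0$, $G_n$ is $M$-uniform in dimension $d$. If $(G_n,o_n)$ converges in distribution (with respect to $\Delta$) to a random rooted graph $(G,o)$, then $G$ is almost surely $d$-parabolic. -/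

import Mathlib

open MeasureTheory Filter
open scoped ENNReal NNReal Topology

/-! ### Sphere packings and their tangency graphs -/

/-- A `d`-dimensional sphere packing indexed by `V`: closed balls of positive radii in `ℝ^d` with
pairwise disjoint interiors. -/
structure SpherePacking (V : Type*) (d : ℕ) where
  center : V → EuclideanSpace ℝ (Fin d)
  radius : V → ℝ
  radius_pos : ∀ v, 0 < radius v
  disjoint_interiors : Pairwise fun u v =>
    Disjoint (interior (Metric.closedBall (center u) (radius u)))
      (interior (Metric.closedBall (center v) (radius v)))

namespace SpherePacking

variable {V W : Type*} {d : ℕ}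

/-- Two balls with disjoint interiors are tangent when the distance between their centers is the
sum of their radii. -/
def Tangent (P : SpherePacking V d) (u v : V) : Prop :=
  dist (P.center u) (P.center v) = P.radius u + P.radius v

/-- The tangency graph of a sphere packing: an edge between `u` and `v` iff their balls are
tangent. -/
def tangencyGraph (P : SpherePacking V d) : SimpleGraph V where
  Adj u v := u ≠ v ∧ P.Tangent u v
  symm := ⟨fun u v h => ⟨h.1.symm, by
    have h2 := h.2
    unfold Tangent at h2 ⊢
    rw [dist_comm, add_comm, h2]⟩⟩
  loopless := ⟨fun _ h => h.1 rfl⟩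

/-- `P` is `M`-uniform: radii of tangent balls have ratio at most `M`. -/
def IsUniform (P : SpherePacking V d) (M : ℝ) : Prop :=
  ∀ u v, u ≠ v → P.Tangent u v → P.radius u / P.radius v ≤ M

/-- Reindexing a packing along an injection. -/
def comp (P : SpherePacking V d) (f : W → V) (hf : Function.Injective f) :
    SpherePacking W d where
  center w := P.center (f w)
  radius w := P.radius (f w)
  radius_pos w := P.radius_pos (f w)
  disjoint_interiors _ _ h := P.disjoint_interiors (hf.ne h)

end SpherePacking

namespace SimpleGraph

variable {V W : Type*}

/-- A graph is `M`-uniform in dimension `d` if it is the tangency graph of an `M`-uniform sphere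
packing in `ℝ^d`. -/
def IsUniformlyPackable (G : SimpleGraph V) (M : ℝ) (d : ℕ) : Prop :=
  ∃ P : SpherePacking V d, P.IsUniform M ∧ P.tangencyGraph = G

theorem IsUniformlyPackable.of_iso {G : SimpleGraph V} {H : SimpleGraph W} (φ : G ≃g H) {M : ℝ}
    {d : ℕ} (h : H.IsUniformlyPackable M d) : G.IsUniformlyPackable M d := by
  obtain ⟨P, hP, hPH⟩ := h
  refine ⟨P.comp φ φ.injective, fun u v huv ht => hP _ _ (φ.injective.ne huv) ht, ?_⟩
  ext u v
  have h1 : P.tangencyGraph.Adj (φ u) (φ v) ↔ G.Adj u v := by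
    have h2 : P.tangencyGraph.Adj (φ u) (φ v) ↔ H.Adj (φ u) (φ v) :=
      iff_of_eq (congrArg (fun K : SimpleGraph W => K.Adj (φ u) (φ v)) hPH)
    exact h2.trans φ.map_adj_iff
  rw [← h1]
  exact and_congr_left fun _ => φ.injective.ne_iff.symm

/-! ### Extremal length and `d`-parabolicity -/

/-- A semi-infinite path in `G` started from `v` (its vertices are pairwise distinct). -/
structure InfinitePath (G : SimpleGraph V) (v : V) where
  toFun : ℕ → V
  map_zero : toFun 0 = v
  adj : ∀ n, G.Adj (toFun n) (toFun (n + 1))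
  injective : Function.Injective toFun

/-- The `m`-length of a path: the sum of `m` over its vertices. -/
noncomputable def InfinitePath.length {G : SimpleGraph V} {v : V} (γ : G.InfinitePath v)
    (m : V → ℝ≥0) : ℝ≥0∞ :=
  ∑' n, (m (γ.toFun n) : ℝ≥0∞)

/-- The `d`-th power `‖m‖_d^d = ∑ v, m(v)^d` of the `L^d` norm of `m`. -/
noncomputable def normPow (d : ℕ) (m : V → ℝ≥0) : ℝ≥0∞ :=
  ∑' v, (m v : ℝ≥0∞) ^ d

/-- The `d`-vertex extremal length of the set of semi-infinite paths started from `v`: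
the supremum over the nonzero `m ∈ L^d(V)` of `inf_γ Length_m(γ)^d / ‖m‖_d^d`
(the infimum over an empty set of paths being `∞`). -/
noncomputable def vertexExtremalLength (G : SimpleGraph V) (d : ℕ) (v : V) : ℝ≥0∞ :=
  ⨆ (m : V → ℝ≥0) (_ : m ≠ 0) (_ : normPow d m ≠ ∞),
    ⨅ γ : G.InfinitePath v, γ.length m ^ d / normPow d m

/-- A graph is `d`-parabolic if the `d`-vertex extremal length of the semi-infinite paths started
from a vertex is infinite, whatever the vertex. -/
def IsParabolic (G : SimpleGraph V) (d : ℕ) : Prop :=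
  ∀ v, G.vertexExtremalLength d v = ∞

/-- The image of a path under an isomorphism. -/
def InfinitePath.map {G : SimpleGraph V} {H : SimpleGraph W} (φ : G ≃g H) {v : V}
    (γ : G.InfinitePath v) : H.InfinitePath (φ v) where
  toFun n := φ (γ.toFun n)
  map_zero := by rw [γ.map_zero]
  adj n := φ.map_adj_iff.2 (γ.adj n)
  injective := φ.injective.comp γ.injective

theorem vertexExtremalLength_le_of_iso {G : SimpleGraph V} {H : SimpleGraph W} (φ : G ≃g H)
    (d : ℕ) (v : V) : H.vertexExtremalLength d (φ v) ≤ G.vertexExtremalLength d v := by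
  refine iSup_le fun m => iSup_le fun hm => iSup_le fun hd => ?_
  have hn : normPow d (m ∘ φ) = normPow d m :=
    φ.toEquiv.tsum_eq fun w => (m w : ℝ≥0∞) ^ d
  have hm' : m ∘ φ ≠ 0 := by
    intro h
    apply hm
    funext w
    have := congrFun h (φ.symm w)
    simpa using this
  refine le_iSup_of_le (m ∘ φ) (le_iSup_of_le hm' (le_iSup_of_le (hn.symm ▸ hd) ?_))
  refine le_iInf fun γ => ?_
  rw [hn]
  exact iInf_le (fun γ : H.InfinitePath (φ v) => γ.length m ^ d / normPow d m) (γ.map φ)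

theorem IsParabolic.of_iso {G : SimpleGraph V} {H : SimpleGraph W} (φ : G ≃g H) {d : ℕ}
    (h : H.IsParabolic d) : G.IsParabolic d := fun v =>
  top_le_iff.1 ((h (φ v)).symm.le.trans (vertexExtremalLength_le_of_iso φ d v))

end SimpleGraph

/-! ### Rooted graphs -/

/-- A locally finite connected rooted graph. (Such a graph is countable, so that `V : Type` covers
all of them up to isomorphism.) -/
structure RootedGraph where
  V : Type
  graph : SimpleGraph V
  root : V
  connected : graph.Connected
  locallyFinite : ∀ v, (graph.neighborSet v).Finite

namespace RootedGraph

/-- Isomorphism of rooted graphs: a graph isomorphism which takes the root to the root. -/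
def Iso (G H : RootedGraph) : Prop :=
  ∃ φ : G.graph ≃g H.graph, φ G.root = H.root

theorem Iso.refl (G : RootedGraph) : G.Iso G := ⟨SimpleGraph.Iso.refl, rfl⟩

theorem Iso.symm {G H : RootedGraph} : G.Iso H → H.Iso G := by
  rintro ⟨φ, h⟩
  exact ⟨φ.symm, by rw [← h]; exact φ.symm_apply_apply _⟩

theorem Iso.trans {G H K : RootedGraph} : G.Iso H → H.Iso K → G.Iso K := by
  rintro ⟨φ, h⟩ ⟨ψ, h'⟩
  exact ⟨φ.trans ψ, by rw [← h', ← h]; rfl⟩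

instance setoid : Setoid RootedGraph where
  r := Iso
  iseqv := ⟨Iso.refl, Iso.symm, Iso.trans⟩

/-- The same graph with another root. -/
def reroot (G : RootedGraph) (v : G.V) : RootedGraph :=
  { G with root := v }

/-- The vertices of the closed ball of radius `k` around the root, for the graph distance. -/
def ballSet (G : RootedGraph) (k : ℕ) : Set G.V :=
  {v | G.graph.dist G.root v ≤ k}

theorem root_mem_ballSet (G : RootedGraph) (k : ℕ) : G.root ∈ G.ballSet k := by
  simp [ballSet]

theorem exists_walk_ball (G : RootedGraph) (k : ℕ) (v : G.ballSet k) :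
    ∃ w : (G.graph.induce (G.ballSet k)).Walk ⟨G.root, G.root_mem_ballSet k⟩ v,
      w.length = G.graph.dist G.root v := by
  classical
  obtain ⟨w, hw⟩ := G.connected.exists_walk_length_eq_dist G.root v
  have hs : ∀ x ∈ w.support, x ∈ G.ballSet k := fun x hx =>
    ((SimpleGraph.dist_le (w.takeUntil x hx)).trans (w.length_takeUntil_le_length hx)).trans
      (hw.le.trans v.2)
  refine ⟨w.induce _ hs, ?_⟩
  rw [← hw, ← SimpleGraph.Walk.length_map (SimpleGraph.Embedding.induce _).toHom (w.induce _ hs),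
    SimpleGraph.Walk.map_induce]
  rfl

/-- The closed ball of radius `k` around the root, as a rooted graph. -/
def ball (G : RootedGraph) (k : ℕ) : RootedGraph where
  V := G.ballSet k
  graph := G.graph.induce (G.ballSet k)
  root := ⟨G.root, G.root_mem_ballSet k⟩
  connected := by
    have h : ∀ v : G.ballSet k, (G.graph.induce (G.ballSet k)).Reachable
        ⟨G.root, G.root_mem_ballSet k⟩ v := fun v => ⟨(G.exists_walk_ball k v).choose⟩
    exact { preconnected := fun u v => (h u).symm.trans (h v)
            nonempty := ⟨⟨G.root, G.root_mem_ballSet k⟩⟩ }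
  locallyFinite v := by
    refine Set.Finite.of_finite_image (f := Subtype.val)
      ((G.locallyFinite v).subset ?_) Subtype.val_injective.injOn
    rintro _ ⟨u, hu, rfl⟩
    exact hu

theorem dist_ball (G : RootedGraph) (k : ℕ) (v : G.ballSet k) :
    (G.graph.induce (G.ballSet k)).dist ⟨G.root, G.root_mem_ballSet k⟩ v =
      G.graph.dist G.root v := by
  obtain ⟨w, hw⟩ := G.exists_walk_ball k v
  refine le_antisymm (hw ▸ SimpleGraph.dist_le w) ?_
  obtain ⟨w', hw'⟩ := w.reachable.exists_walk_length_eq_dist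
  rw [← hw', ← SimpleGraph.Walk.length_map (SimpleGraph.Embedding.induce (G.ballSet k)).toHom w']
  exact SimpleGraph.dist_le _

theorem dist_iso {V W : Type*} {G : SimpleGraph V} {H : SimpleGraph W} (φ : G ≃g H)
    (hG : G.Connected) (u v : V) : H.dist (φ u) (φ v) ≤ G.dist u v := by
  obtain ⟨w, hw⟩ := hG.exists_walk_length_eq_dist u v
  rw [← hw, ← SimpleGraph.Walk.length_map φ.toHom w]
  exact SimpleGraph.dist_le _

theorem Iso.ball {G H : RootedGraph} (h : G.Iso H) (k : ℕ) : (G.ball k).Iso (H.ball k) := by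
  obtain ⟨φ, h⟩ := h
  have hd : ∀ v, H.graph.dist H.root (φ v) = G.graph.dist G.root v := fun v => by
    refine le_antisymm (h ▸ dist_iso φ G.connected _ _) ?_
    have := dist_iso φ.symm H.connected H.root (φ v)
    rw [← h, φ.symm_apply_apply, φ.symm_apply_apply] at this
    exact h ▸ this
  refine ⟨⟨φ.toEquiv.subtypeEquiv fun v => ?_, ?_⟩, Subtype.ext h⟩
  · change G.graph.dist G.root v ≤ k ↔ H.graph.dist H.root (φ v) ≤ k
    rw [hd]
  · intro u v
    exact φ.map_adj_iff

theorem ball_ball (G : RootedGraph) {j k : ℕ} (h : j ≤ k) :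
    ((G.ball k).ball j).Iso (G.ball j) := by
  have hm : ∀ v : (G.ball k).V, v ∈ (G.ball k).ballSet j ↔ v.1 ∈ G.ballSet j := fun v =>
    iff_of_eq (congrArg (· ≤ j) (G.dist_ball k v))
  refine ⟨⟨⟨fun v => ⟨v.1.1, (hm v.1).1 v.2⟩,
    fun v => ⟨⟨v.1, le_trans (show G.graph.dist G.root v.1 ≤ j from v.2) h⟩, (hm _).2 v.2⟩,
    fun _ => rfl, fun _ => rfl⟩, ?_⟩, rfl⟩
  intro u v
  exact Iff.rfl

end RootedGraph

/-- The space of isomorphism classes of locally finite connected rooted graphs. -/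
def RootedGraphClass : Type 1 := Quotient RootedGraph.setoid

namespace RootedGraphClass

/-- The isomorphism class of a rooted graph. -/
def mk (G : RootedGraph) : RootedGraphClass := Quotient.mk RootedGraph.setoid G

/-- The isomorphism class of the closed ball of radius `k` around the root. -/
def ball (X : RootedGraphClass) (k : ℕ) : RootedGraphClass :=
  Quotient.lift (fun G => mk (G.ball k)) (fun _ _ h => Quotient.sound (RootedGraph.Iso.ball h k)) X

theorem ball_ball (X : RootedGraphClass) {j k : ℕ} (h : j ≤ k) : (X.ball k).ball j = X.ball j := by
  induction X using Quotient.inductionOn with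
  | h G => exact Quotient.sound (G.ball_ball h)

/-- The supremum of the radii `k` at which the balls of `X` and `Y` are isomorphic. -/
noncomputable def agreement (X Y : RootedGraphClass) : ℝ≥0∞ :=
  ⨆ (k : ℕ) (_ : X.ball k = Y.ball k), (k : ℝ≥0∞)

/-- The local distance `(1 + sup {k : the balls of radius k are isomorphic})⁻¹`. -/
noncomputable def localDist (X Y : RootedGraphClass) : ℝ :=
  ((1 + agreement X Y)⁻¹).toReal

theorem min_agreement_le (X Y Z : RootedGraphClass) :
    min (agreement X Y) (agreement Y Z) ≤ agreement X Z := by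
  refine le_of_forall_lt fun c hc => ?_
  rw [lt_min_iff] at hc
  obtain ⟨h1, h2⟩ := hc
  simp only [agreement, lt_iSup_iff] at h1 h2 ⊢
  obtain ⟨i, hi, hci⟩ := h1
  obtain ⟨j, hj, hcj⟩ := h2
  have key : ∀ {A B : RootedGraphClass} {l k : ℕ}, l ≤ k → A.ball k = B.ball k →
      A.ball l = B.ball l := fun hlk hk => by
    rw [← ball_ball _ hlk, hk, ball_ball _ hlk]
  rcases le_total i j with hij | hij
  · exact ⟨i, hi.trans (key hij hj), hci⟩
  · exact ⟨j, (key hij hi).trans hj, hcj⟩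

theorem inv_one_add_ne_top (a : ℝ≥0∞) : (1 + a)⁻¹ ≠ ∞ := by simp

/-- The local topology, given by the local distance. -/
noncomputable instance : PseudoMetricSpace RootedGraphClass where
  dist := localDist
  dist_self X := by
    have : agreement X X = ∞ := by
      refine ENNReal.eq_top_of_forall_nnreal_le fun r => ?_
      obtain ⟨n, hn⟩ := exists_nat_ge r
      refine le_trans ?_ (le_iSup₂_of_le (f := fun (k : ℕ) (_ : X.ball k = X.ball k) =>
        (k : ℝ≥0∞)) n rfl le_rfl)
      exact_mod_cast hn
    simp [localDist, this]
  dist_comm X Y := by simp only [localDist, agreement, eq_comm]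
  dist_triangle X Y Z := by
    have h := min_agreement_le X Y Z
    have mono : ∀ {a b : ℝ≥0∞}, a ≤ b → ((1 + b)⁻¹).toReal ≤ ((1 + a)⁻¹).toReal := fun hab =>
      ENNReal.toReal_mono (inv_one_add_ne_top _) (ENNReal.inv_le_inv.2 (add_le_add_right hab 1))
    unfold localDist
    rcases min_le_iff.1 h with h' | h'
    · exact (mono h').trans (le_add_of_nonneg_right ENNReal.toReal_nonneg)
    · exact (mono h').trans (le_add_of_nonneg_left ENNReal.toReal_nonneg)

noncomputable instance : MeasurableSpace RootedGraphClass := borel _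

instance : BorelSpace RootedGraphClass := ⟨rfl⟩

/-- The underlying graph is finite. -/
def IsFinite (X : RootedGraphClass) : Prop :=
  Quotient.lift (fun G : RootedGraph => Finite G.V)
    (fun _ _ h => propext (Exists.choose h).toEquiv.finite_iff) X

/-- The underlying graph is `M`-uniform in dimension `d`. -/
def IsUniformlyPackable (X : RootedGraphClass) (M : ℝ) (d : ℕ) : Prop :=
  Quotient.lift (fun G : RootedGraph => G.graph.IsUniformlyPackable M d)
    (fun _ _ h => propext
      ⟨.of_iso (Exists.choose h).symm, .of_iso (Exists.choose h)⟩) X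

/-- The underlying graph is `d`-parabolic. -/
def IsParabolic (X : RootedGraphClass) (d : ℕ) : Prop :=
  Quotient.lift (fun G : RootedGraph => G.graph.IsParabolic d)
    (fun _ _ h => propext
      ⟨.of_iso (Exists.choose h).symm, .of_iso (Exists.choose h)⟩) X

/-- The set of the classes whose underlying (unrooted) graph is isomorphic to that of `H`. -/
def withGraph (H : RootedGraph) : Set RootedGraphClass :=
  Set.range fun v : H.V => mk (H.reroot v)

/-- The law of the graph of `H` rooted at a uniformly chosen vertex. -/
noncomputable def uniformRootLaw (H : RootedGraph) [Finite H.V] : Measure RootedGraphClass :=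
  letI : Fintype H.V := Fintype.ofFinite H.V
  letI : Nonempty H.V := ⟨H.root⟩
  ((PMF.uniformOfFintype H.V).map fun v => mk (H.reroot v)).toMeasure

/-- The law `μ` of a random rooted graph `(G, o)` is unbiased if `G` is almost surely finite and,
conditionally on the unrooted graph `G`, the root is uniform over the vertices of `G`. -/
def IsUnbiased (μ : Measure RootedGraphClass) : Prop :=
  (∀ᵐ X ∂μ, X.IsFinite) ∧
    ∀ (H : RootedGraph) [Finite H.V], μ (withGraph H) ≠ 0 →
      ProbabilityTheory.cond μ (withGraph H) = uniformRootLaw H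

end RootedGraphClass

/-! Parabolicity is reduced to a capacity estimate that passes to local limits. Suppose `f` vanishes
at the root, is at least `1` off `s` vertices, and has gradient bounded by `m` with `normPow d m`
tiny. A path from the root must reach `f ≥ 1` within its first `s + 1` vertices, so its `m`-length
is at least about `1`. The extremal length is then at least of order `1 / normPow d m`. Only a ball
of finite radius matters, so this is a local event (`isParabolic_of_hasSmallCapacity`).

In a finite packing such an `f` exists at most vertices. Seen from `o` at the scale of its own
radius, the centres typically have at most one accumulation point: for all but `C |V| / s` vertices
`o`, fewer than `s` centres lie within `r_o / δ` of `o` but outside some ball of radius `δ r_o`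
(`card_supportedPoints_le`). This is the Benjamini-Schramm lemma, obtained here by counting in
nested shifted grids. For such an `o`, one logarithmic potential makes `f` equal to `1` far from
`o`, and another makes it equal to `1` near the accumulation point. By volume, each of `N` separated
annuli costs bounded `d`-energy. Averaging over them gives energy `O(N ^ (1 - d))`, which is small
because `d ≥ 2` (`exists_annular_potential`).

For an unbiased root the bad event thus has probability at most `C / s`, with `C` independent of the
graph and of the radius of the ball in which the event is tested. The event depends on that ball
only, hence is clopen, and the bound survives in the limit. Letting `s` grow gives, almost surely,
some finite `s` for every energy level. -/

namespace SimpleGraph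

/-! ### Capacity potentials and extremal length. -/

variable {V W : Type*}

/-- There is a potential vanishing at `o`, equal to at least `1` off `s` vertices, whose gradient
is dominated by a vertex function of small `L^d` norm. -/
def HasSmallCapacity (G : SimpleGraph V) (o : V) (d s : ℕ) (ε : ℝ≥0∞) : Prop :=
  ∃ (f : V → ℝ) (m : V → ℝ≥0), f o = 0 ∧ (∀ u v, G.Adj u v → |f u - f v| ≤ m u) ∧
    {v | f v < 1}.encard ≤ s ∧ normPow d m ≤ ε

/-- Restricting `f` and `m` to a subgraph only removes constraints, exceptional vertices and energy.
This turns a global estimate on a finite graph into one on balls. -/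
theorem HasSmallCapacity.comap {G : SimpleGraph V} {H : SimpleGraph W} {o : V} {d s : ℕ} {ε : ℝ≥0∞}
    (h : G.HasSmallCapacity o d s ε) (φ : H →g G) (hφ : Function.Injective φ) {w : W}
    (hw : φ w = o) : H.HasSmallCapacity w d s ε := by
  obtain ⟨f, m, h0, h1, h2, h3⟩ := h
  refine ⟨f ∘ φ, m ∘ φ, by simp [hw, h0], fun u v huv => h1 _ _ (φ.map_adj huv), ?_, ?_⟩
  · refine le_trans ?_ h2
    rw [← hφ.encard_image]
    exact Set.encard_le_encard (by rintro _ ⟨v, hv, rfl⟩; exact hv)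
  · exact (ENNReal.tsum_comp_le_tsum_of_injective hφ fun v => (m v : ℝ≥0∞) ^ d).trans h3

/-- A potential changes along a walk by at most the number of steps times the gradient bound. -/
theorem Walk.abs_sub_le {G : SimpleGraph V} {f : V → ℝ} {c : ℝ}
    (h : ∀ u v, G.Adj u v → |f u - f v| ≤ c) {u v : V} (w : G.Walk u v) :
    |f u - f v| ≤ w.length * c := by
  induction w with
  | nil => simp
  | @cons a b e hab w ih =>
    have := h _ _ hab
    have h3 := _root_.abs_sub_le (f a) (f b) (f e)
    rw [Walk.length_cons]
    push_cast
    linarith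

theorem vertexExtremalLength_eq_top_of_isEmpty (G : SimpleGraph V) {d : ℕ} (hd : d ≠ 0) (v : V)
    [IsEmpty (G.InfinitePath v)] : G.vertexExtremalLength d v = ∞ := by
  classical
  refine top_le_iff.1 ?_
  refine le_iSup_of_le (Pi.single v 1) (le_iSup_of_le (by simp) (le_iSup_of_le ?_ ?_))
  · unfold normPow
    rw [tsum_eq_single v]
    · simp
    · intro u hu
      simp [hu, hd]
  · simp

end SimpleGraph

namespace RootedGraph

open SimpleGraph

theorem dist_root_le_of_adj (G : RootedGraph) {u v : G.V} (h : G.graph.Adj u v) :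
    G.graph.dist G.root v ≤ G.graph.dist G.root u + 1 :=
  (G.connected.dist_triangle (v := u)).trans (by
    gcongr
    exact (SimpleGraph.dist_eq_one_iff_adj.2 h).le)

theorem dist_root_path (G : RootedGraph) {v : G.V} (γ : G.graph.InfinitePath v) (n : ℕ) :
    G.graph.dist G.root (γ.toFun n) ≤ G.graph.dist G.root v + n := by
  induction n with
  | zero => simp [γ.map_zero]
  | succ n ih =>
    have := G.dist_root_le_of_adj (γ.adj n)
    omega

/-- A path started at distance `j` from the root has length at least `1/2`, provided that the
gradient is small enough: one of its first `s + 1` vertices is a point where `f` is at least `1`. -/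
theorem half_le_length (G : RootedGraph) {f : G.V → ℝ} {m : G.V → ℝ≥0} {s j : ℕ}
    (h0 : f G.root = 0)
    (h1 : ∀ u ∈ G.ballSet (s + j), ∀ v ∈ G.ballSet (s + j), G.graph.Adj u v → |f u - f v| ≤ m u)
    (h2 : {v | v ∈ G.ballSet (s + j) ∧ f v < 1}.encard ≤ s)
    (h3 : ∀ u, (m u : ℝ) ≤ 1 / (2 * (j + 1)))
    {v : G.V} (hv : G.graph.dist G.root v = j) (γ : G.graph.InfinitePath v) :
    (2⁻¹ : ℝ≥0∞) ≤ γ.length m := by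
  have hball : ∀ n ≤ s, γ.toFun n ∈ G.ballSet (s + j) := fun n hn => by
    have := G.dist_root_path γ n
    change G.graph.dist G.root (γ.toFun n) ≤ s + j
    omega
  obtain ⟨i, his, hi⟩ : ∃ i ≤ s, 1 ≤ f (γ.toFun i) := by
    by_contra! hcon
    have h4 : (γ.toFun '' (Set.Iic s)).encard ≤ s := by
      refine le_trans (Set.encard_le_encard ?_) h2
      rintro _ ⟨n, hn, rfl⟩
      exact ⟨hball n hn, hcon n hn⟩
    rw [γ.injective.encard_image, ← Finset.coe_Iic, Set.encard_coe_eq_coe_finsetCard,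
      Nat.card_Iic] at h4
    have : s + 1 ≤ s := by exact_mod_cast h4
    omega
  -- A walk of `j` steps inside the ball joins the root to `v`, and each step changes `f` by at most
  -- `1 / (2 (j + 1))`.
  have hvle : f v ≤ 1 / 2 := by
    let v' : G.ballSet (s + j) := ⟨v, by change G.graph.dist G.root v ≤ s + j; omega⟩
    obtain ⟨w, hw⟩ := G.exists_walk_ball (s + j) v'
    have := Walk.abs_sub_le (f := fun u : G.ballSet (s + j) => f u) (c := 1 / (2 * (j + 1)))
      (fun u v huv => (h1 u u.2 v v.2 huv).trans (h3 _)) w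
    rw [hw] at this
    simp only [h0, zero_sub, abs_neg, v', hv] at this
    refine (le_abs_self _).trans (this.trans ?_)
    rw [mul_one_div, div_le_div_iff₀ (by positivity) (by positivity)]
    linarith
  have htel : ∀ n ≤ s, f (γ.toFun n) - f v ≤ ∑ l ∈ Finset.range n, (m (γ.toFun l) : ℝ) := by
    intro n
    induction n with
    | zero => intro _; simp [γ.map_zero]
    | succ n ih =>
      intro hn
      have h5 := ih (by omega)
      have h6 := h1 _ (hball n (by omega)) _ (hball (n + 1) hn) (γ.adj n)
      have h7 := neg_le_of_abs_le h6
      rw [Finset.sum_range_succ]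
      linarith
  have h8 : (2⁻¹ : ℝ) ≤ ((∑ l ∈ Finset.range i, m (γ.toFun l) : ℝ≥0) : ℝ) := by
    push_cast
    have := htel i his
    norm_num at *
    linarith
  have h9 : (2⁻¹ : ℝ≥0) ≤ ∑ l ∈ Finset.range i, m (γ.toFun l) := by exact_mod_cast h8
  calc (2⁻¹ : ℝ≥0∞) = ((2⁻¹ : ℝ≥0) : ℝ≥0∞) := by simp
    _ ≤ ((∑ l ∈ Finset.range i, m (γ.toFun l) : ℝ≥0) : ℝ≥0∞) := by exact_mod_cast h9
    _ = ∑ l ∈ Finset.range i, (m (γ.toFun l) : ℝ≥0∞) := by push_cast; rfl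
    _ ≤ _ := ENNReal.sum_le_tsum _

/-- The radius `s + j` contains the first `s + 1` vertices of any path started at distance `j` from
the root, so potentials on balls suffice for every starting vertex. -/
theorem isParabolic_of_hasSmallCapacity (G : RootedGraph) {d : ℕ} (hd : d ≠ 0)
    (h : ∀ n j : ℕ, ∃ s, (G.ball (s + j)).graph.HasSmallCapacity (G.ball (s + j)).root d s
      (n + 1 : ℝ≥0∞)⁻¹) : G.graph.IsParabolic d := by
  classical
  intro v
  rcases isEmpty_or_nonempty (G.graph.InfinitePath v) with hE | ⟨⟨γ₀⟩⟩
  · exact G.graph.vertexExtremalLength_eq_top_of_isEmpty hd v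
  refine ENNReal.eq_top_of_forall_nnreal_le fun r => ?_
  obtain ⟨j, hj⟩ : ∃ j, G.graph.dist G.root v = j := ⟨_, rfl⟩
  -- The first bound makes the ratio at least `r`; the second forces the pointwise bound `m ≤ 1 / (2
  -- (j + 1))`.
  obtain ⟨n, hn⟩ := exists_nat_ge (max (r * 2 ^ d) ((2 * (j + 1)) ^ d) : ℝ≥0)
  obtain ⟨s, f', m', h0, h1, h2, h3⟩ := h n j
  let f : G.V → ℝ := fun u => if hu : u ∈ G.ballSet (s + j) then f' ⟨u, hu⟩ else 0
  let m : G.V → ℝ≥0 := fun u => if hu : u ∈ G.ballSet (s + j) then m' ⟨u, hu⟩ else 0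
  have hnorm : normPow d m = normPow d m' := by
    unfold normPow
    have : (fun u => (m u : ℝ≥0∞) ^ d) =
        (G.ballSet (s + j)).indicator (fun u => (m u : ℝ≥0∞) ^ d) := by
      ext u
      by_cases hu : u ∈ G.ballSet (s + j)
      · simp [hu]
      · simp [hu, m, hd]
    rw [this, ← tsum_subtype]
    refine tsum_congr fun u => ?_
    simp [m]
  rw [← hnorm] at h3
  have hm : ∀ u, (m u : ℝ) ≤ 1 / (2 * (j + 1)) := by
    intro u
    have h4 : (m u : ℝ≥0∞) ^ d ≤ (n + 1 : ℝ≥0∞)⁻¹ :=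
      (ENNReal.le_tsum (f := fun u => (m u : ℝ≥0∞) ^ d) u).trans h3
    have h5 : (m u) ^ d ≤ (n + 1 : ℝ≥0)⁻¹ := by
      have : ((m u ^ d : ℝ≥0) : ℝ≥0∞) ≤ ((n + 1 : ℝ≥0)⁻¹ : ℝ≥0) := by
        rw [ENNReal.coe_inv (by positivity)]
        push_cast
        exact h4
      exact_mod_cast this
    have h6 : m u ≤ (2 * (j + 1) : ℝ≥0)⁻¹ := by
      refine (pow_le_pow_iff_left₀ (by positivity) (by positivity) hd).1 (h5.trans ?_)
      rw [inv_pow]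
      refine inv_anti₀ (by positivity) ?_
      exact (le_max_right _ _).trans (hn.trans (by simp))
    have : (m u : ℝ) ≤ ((2 * (j + 1) : ℝ≥0)⁻¹ : ℝ≥0) := by exact_mod_cast h6
    simpa using this
  have hlen : ∀ γ : G.graph.InfinitePath v, (2⁻¹ : ℝ≥0∞) ≤ γ.length m := by
    intro γ
    refine G.half_le_length (f := f) (s := s) (j := j) ?_ ?_ ?_ hm hj γ
    · have : f G.root = f' ⟨G.root, G.root_mem_ballSet _⟩ := dif_pos (G.root_mem_ballSet _)
      rw [this]; exact h0
    · intro u hu w hw huw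
      have := h1 ⟨u, hu⟩ ⟨w, hw⟩ huw
      simpa [f, m, hu, hw] using this
    · refine le_trans ?_ h2
      have hinj : Function.Injective fun u : (G.ball (s + j)).V => u.1 := Subtype.val_injective
      refine le_trans (Set.encard_le_encard ?_) (hinj.encard_image _).le
      rintro u ⟨hu, hfu⟩
      refine ⟨⟨u, hu⟩, ?_, rfl⟩
      change f' ⟨u, hu⟩ < 1
      simpa [f, hu] using hfu
  have hm0 : m ≠ 0 := by
    intro hm0
    have := hlen γ₀
    simp [InfinitePath.length, hm0] at this
  refine le_iSup_of_le m (le_iSup_of_le hm0 (le_iSup_of_le ?_ ?_))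
  · exact ne_top_of_le_ne_top (by simp) h3
  · refine le_iInf fun γ => ?_
    calc (r : ℝ≥0∞) ≤ (2⁻¹) ^ d / (n + 1 : ℝ≥0∞)⁻¹ := by
          rw [div_eq_mul_inv, inv_inv, ← ENNReal.inv_pow, mul_comm, ← div_eq_mul_inv,
            ENNReal.le_div_iff_mul_le (by simp) (by simp)]
          have : r * 2 ^ d ≤ (n : ℝ≥0) + 1 :=
            (le_max_left _ _).trans (hn.trans (by simp))
          exact_mod_cast this
      _ ≤ _ := by
        gcongr
        exact hlen γ

end RootedGraph

/-! ### Counting in nested partitions. -/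

/-- The convex piecewise linear function `x ↦ max (2 x - s) 0` gains `s` on a sum of which every
term misses at least `s`. -/
theorem Finset.sum_two_mul_tsub_add_le {β : Type*} [DecidableEq β] (B : Finset β) (x : β → ℕ)
    (s : ℕ) (h : ∀ b, s ≤ ∑ c ∈ B.erase b, x c) (hB : B.Nonempty) :
    ∑ b ∈ B, (2 * x b - s) + s ≤ 2 * ∑ b ∈ B, x b - s := by
  have hsup : ∀ A : Finset β, ∑ b ∈ A, (2 * x b - s) ≤ 2 * ∑ b ∈ A, x b - s := by
    intro A
    induction A using Finset.induction_on with
    | empty => simp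
    | insert a A ha ih =>
      rw [Finset.sum_insert ha, Finset.sum_insert ha]
      omega
  by_cases hb : ∃ b ∈ B, s < 2 * x b
  · obtain ⟨b, hbB, hb⟩ := hb
    have h1 := hsup (B.erase b)
    have h2 := h b
    rw [← Finset.add_sum_erase _ _ hbB, ← Finset.add_sum_erase _ _ hbB]
    omega
  · push Not at hb
    have h1 : ∑ b ∈ B, (2 * x b - s) = 0 := Finset.sum_eq_zero fun b hbB => by
      have := hb b hbB
      omega
    obtain ⟨b, hbB⟩ := hB
    have h2 := h b
    have h3 : ∑ c ∈ B.erase b, x c ≤ ∑ c ∈ B, x c :=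
      Finset.sum_le_sum_of_subset (Finset.erase_subset _ _)
    omega

theorem Finset.sum_two_mul_tsub_le {β : Type*} (B : Finset β) (x : β → ℕ) (s : ℕ) :
    ∑ b ∈ B, (2 * x b - s) ≤ 2 * ∑ b ∈ B, x b - s := by
  classical
  induction B using Finset.induction_on with
  | empty => simp
  | insert a A ha ih =>
    rw [Finset.sum_insert ha, Finset.sum_insert ha]
    omega

section Laminar

variable {V α : Type*} [Fintype V] [DecidableEq α]

open scoped Classical in
/-- The cells of level `n + 1` no child of which contains all but fewer than `s` of its points. -/
noncomputable def supportedCells (c : ℕ → V → α) (s n : ℕ) : Finset α :=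
  (Finset.univ.image (c (n + 1))).filter fun a =>
    ∀ b, s ≤ (Finset.univ.filter fun u => c (n + 1) u = a ∧ c n u ≠ b).card

/-- In a nested sequence of partitions, the number of supported cells is at most `2 |V| / s`. -/
theorem card_supportedCells_le (c : ℕ → V → α)
    (hc : ∀ n u v, c n u = c n v → c (n + 1) u = c (n + 1) v) (s L : ℕ) :
    s * ∑ n ∈ Finset.range L, (supportedCells c s n).card ≤ 2 * Fintype.card V := by
  classical
  let cell : ℕ → α → ℕ := fun n a => (Finset.univ.filter fun u => c n u = a).card
  -- A monotone quantity: with truncated subtraction, merging cells never decreases `Φ`, each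
  -- supported cell increases it by at least `s`, and it never exceeds `2 |V|`.
  let Φ : ℕ → ℕ := fun n => ∑ a ∈ Finset.univ.image (c n), (2 * cell n a - s)
  have hΦ : ∀ n, Φ n ≤ 2 * Fintype.card V := by
    intro n
    refine (Finset.sum_two_mul_tsub_le _ _ _).trans ((Nat.sub_le _ _).trans ?_)
    have : ∑ a ∈ Finset.univ.image (c n), cell n a = Fintype.card V := by
      rw [← Finset.card_univ, Finset.card_eq_sum_card_image (c n)]
    rw [this]
  have hstep : ∀ n, Φ n + s * (supportedCells c s n).card ≤ Φ (n + 1) := by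
    intro n
    let ch : α → Finset α := fun a => (Finset.univ.filter fun u => c (n + 1) u = a).image (c n)
    have hcell : ∀ a, ∀ b ∈ ch a,
        cell n b = (Finset.univ.filter fun u => c (n + 1) u = a ∧ c n u = b).card := by
      intro a b hb
      obtain ⟨v, hv, rfl⟩ := Finset.mem_image.1 hb
      have hv' : c (n + 1) v = a := (Finset.mem_filter.1 hv).2
      change (Finset.univ.filter fun u => c n u = c n v).card = _
      congr 1
      ext u
      simp only [Finset.mem_filter, Finset.mem_univ, true_and]
      exact ⟨fun h => ⟨(hc n u v h).trans hv', h⟩, fun h => h.2⟩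
    have hsum : ∀ a, ∀ p : α → Prop, ∀ _ : DecidablePred p,
        ∑ b ∈ (ch a).filter p, cell n b =
          (Finset.univ.filter fun u => c (n + 1) u = a ∧ p (c n u)).card := by
      intro a p _
      rw [Finset.card_eq_sum_card_fiberwise (f := c n) (t := (ch a).filter p)]
      · refine Finset.sum_congr rfl fun b hb => ?_
        obtain ⟨hb1, hb2⟩ := Finset.mem_filter.1 hb
        rw [hcell a b hb1, Finset.filter_filter]
        congr 1
        ext u
        simp only [Finset.mem_filter, Finset.mem_univ, true_and]
        constructor
        · rintro ⟨h1, rfl⟩; exact ⟨⟨h1, hb2⟩, rfl⟩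
        · rintro ⟨⟨h1, _⟩, h3⟩; exact ⟨h1, h3⟩
      · intro u hu
        simp only [Finset.coe_filter, Finset.mem_univ, true_and, Set.mem_ofPred_eq] at hu
        simp only [Finset.coe_filter, Set.mem_ofPred_eq, ch, Finset.mem_image, Finset.mem_filter,
          Finset.mem_univ, true_and]
        exact ⟨⟨u, hu.1, rfl⟩, hu.2⟩
    have hsum' : ∀ a, ∑ b ∈ ch a, cell n b = cell (n + 1) a := by
      intro a
      have := hsum a (fun _ => True) (fun _ => instDecidableTrue)
      simpa using this
    have hpart : Φ n = ∑ a ∈ Finset.univ.image (c (n + 1)), ∑ b ∈ ch a, (2 * cell n b - s) := by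
      rw [← Finset.sum_biUnion]
      · refine Finset.sum_congr ?_ fun _ _ => rfl
        ext b
        simp only [Finset.mem_biUnion, Finset.mem_image, Finset.mem_filter, Finset.mem_univ,
          true_and, exists_exists_eq_and, ch]
        exact ⟨fun ⟨v, hv⟩ => ⟨v, v, rfl, hv⟩, fun ⟨_, v, _, hv⟩ => ⟨v, hv⟩⟩
      · intro a _ a' _ haa'
        rw [Function.onFun, Finset.disjoint_left]
        rintro b hb hb'
        obtain ⟨v, hv, hvb⟩ := Finset.mem_image.1 hb
        obtain ⟨v', hv', hvb'⟩ := Finset.mem_image.1 hb'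
        apply haa'
        rw [← (Finset.mem_filter.1 hv).2, ← (Finset.mem_filter.1 hv').2]
        exact hc n _ _ (hvb.trans hvb'.symm)
    have hsupp : s * (supportedCells c s n).card =
        ∑ a ∈ Finset.univ.image (c (n + 1)),
          if ∀ b, s ≤ (Finset.univ.filter fun u => c (n + 1) u = a ∧ c n u ≠ b).card
          then s else 0 := by
      rw [← Finset.sum_filter, Finset.sum_const, smul_eq_mul, mul_comm]
      rfl
    rw [hpart, hsupp, ← Finset.sum_add_distrib]
    refine Finset.sum_le_sum fun a ha => ?_
    rw [← hsum' a]
    split_ifs with hs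
    · refine Finset.sum_two_mul_tsub_add_le _ _ _ (fun b => ?_) ?_
      · have := hsum a (fun x => x ≠ b) inferInstance
        rw [Finset.filter_ne'] at this
        rw [this]
        exact hs b
      · obtain ⟨v, _, hv⟩ := Finset.mem_image.1 ha
        exact ⟨c n v, Finset.mem_image_of_mem _ (by simp [hv])⟩
    · exact Finset.sum_two_mul_tsub_le _ _ _
  have hL : ∀ L, s * ∑ n ∈ Finset.range L, (supportedCells c s n).card ≤ Φ L := by
    intro L
    induction L with
    | zero => simp
    | succ n ih =>
      rw [Finset.sum_range_succ, mul_add]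
      have := hstep n
      omega
  exact (hL L).trans (hΦ L)

end Laminar

/-! ### Volume bounds for packings. -/

namespace SpherePacking

variable {V : Type*} {d : ℕ} (P : SpherePacking V d)

theorem radius_add_radius_le_dist {u v : V} (h : u ≠ v) :
    P.radius u + P.radius v ≤ dist (P.center u) (P.center v) := by
  have h1 := P.disjoint_interiors h
  beta_reduce at h1
  rwa [interior_closedBall _ (P.radius_pos u).ne', interior_closedBall _ (P.radius_pos v).ne',
    disjoint_ball_ball_iff (P.radius_pos u) (P.radius_pos v)] at h1

theorem sum_radius_pow_le (S : Finset V) (p : EuclideanSpace ℝ (Fin d)) {R : ℝ} (hR : 0 ≤ R)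
    (h : ∀ u ∈ S, dist (P.center u) p + P.radius u ≤ R) :
    ∑ u ∈ S, P.radius u ^ d ≤ R ^ d := by
  have h1 : ∑ u ∈ S, volume.real (Metric.ball (P.center u) (P.radius u)) ≤
      volume.real (Metric.closedBall p R) := by
    rw [← measureReal_biUnion_finset]
    · refine measureReal_mono (Set.iUnion₂_subset fun u hu => ?_) measure_closedBall_lt_top.ne
      exact Metric.ball_subset_closedBall.trans
        (Metric.closedBall_subset_closedBall' (by linarith [h u hu]))
    · intro u _ v _ huv
      exact Metric.ball_disjoint_ball (P.radius_add_radius_le_dist huv)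
    · exact fun u _ => measurableSet_ball
  have h2 : ∀ u, volume.real (Metric.ball (P.center u) (P.radius u)) =
      P.radius u ^ d * volume.real (Metric.ball (0 : EuclideanSpace ℝ (Fin d)) 1) := fun u => by
    rw [measureReal_def, Measure.addHaar_ball_of_pos _ _ (P.radius_pos u), ENNReal.toReal_mul,
      ENNReal.toReal_ofReal (pow_nonneg (P.radius_pos u).le _), finrank_euclideanSpace,
      Fintype.card_fin, measureReal_def]
  simp only [h2, Measure.addHaar_real_closedBall _ _ hR, finrank_euclideanSpace, Fintype.card_fin] at h1
  rw [← Finset.sum_mul] at h1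
  refine le_of_mul_le_mul_right h1 ?_
  exact ENNReal.toReal_pos (Metric.measure_ball_pos _ _ one_pos).ne' measure_ball_lt_top.ne

end SpherePacking

/-! ### Nested shifted grids -/

theorem Int.floor_sub_div_eq {y y' : ℝ} (z : ℤ) {μ : ℕ} (h : ⌊y⌋ = ⌊y'⌋) :
    ⌊(y - z) / μ⌋ = ⌊(y' - z) / μ⌋ := by
  have key : ∀ y : ℝ, ⌊(y - z) / μ⌋ = (⌊y⌋ - z) / (μ : ℤ) := by
    intro y
    rw [← Int.floor_sub_intCast]
    exact Int.floor_div_natCast _ _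
  rw [key, key, h]

/-- One of the two grids shifted by `0` and `1/3` separates no two points at distance less than
`1/6` from a given point. -/
theorem exists_floor_sub_third_eq (t : ℝ) : ∃ a : Fin 2, ∀ t' : ℝ, |t' - t| < 1 / 6 →
    ⌊t' - (a : ℕ) / 3⌋ = ⌊t - (a : ℕ) / 3⌋ := by
  have h1 := Int.floor_le t
  have h2 := Int.lt_floor_add_one t
  by_cases h : (⌊t⌋ : ℝ) + 1 / 6 ≤ t ∧ t ≤ ⌊t⌋ + 5 / 6
  · refine ⟨0, fun t' ht => ?_⟩
    rw [abs_lt] at ht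
    have h3 : ⌊t'⌋ = ⌊t⌋ := by
      rw [Int.floor_eq_iff]
      constructor <;> linarith [h.1, h.2]
    simpa using h3
  · refine ⟨1, fun t' ht => ?_⟩
    have h3 : (((1 : Fin 2) : ℕ) : ℝ) = 1 := by simp
    rw [h3]
    rw [abs_lt] at ht
    by_cases h4 : (⌊t⌋ : ℝ) + 1 / 6 ≤ t
    · have h5 : ⌊t⌋ + 5 / 6 < t := by
        by_contra! h6
        exact h ⟨h4, h6⟩
      trans ⌊t⌋
      · rw [Int.floor_eq_iff]
        constructor <;> linarith
      · symm
        rw [Int.floor_eq_iff]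
        constructor <;> linarith
    · trans ⌊t⌋ - 1
      · rw [Int.floor_eq_iff]
        push_cast
        constructor <;> linarith
      · symm
        rw [Int.floor_eq_iff]
        push_cast
        constructor <;> linarith

/-- The cell of level `n` containing `x`, in the grid of mesh `b μ ^ n` shifted by a third of the
mesh in the directions where `α` does not vanish. -/
noncomputable def gridCell {d : ℕ} (b : ℝ) (μ : ℕ) (α : Fin d → Fin 2) (n : ℕ)
    (x : EuclideanSpace ℝ (Fin d)) : Fin d → ℤ :=
  fun i => ⌊x i / (b * μ ^ n) - ((α i : ℕ) : ℝ) / 3⌋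

/-- A mesh ratio congruent to `1` modulo `3` keeps shifted grids nested: `(3 q + 1) / 3 = q + 1 /
3`, so the shift of the coarse grid is that of the fine one up to an integer. -/
theorem gridCell_succ_eq {d : ℕ} {b : ℝ} (hb : 0 < b) (q : ℕ) (α : Fin d → Fin 2) {n : ℕ}
    {x y : EuclideanSpace ℝ (Fin d)} (h : gridCell b (3 * q + 1) α n x =
      gridCell b (3 * q + 1) α n y) :
    gridCell b (3 * q + 1) α (n + 1) x = gridCell b (3 * q + 1) α (n + 1) y := by
  have hμ : ((3 * q + 1 : ℕ) : ℝ) ≠ 0 := by positivity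
  have key : ∀ (z : EuclideanSpace ℝ (Fin d)) (i : Fin d), gridCell b (3 * q + 1) α (n + 1) z i =
      ⌊((z i / (b * (3 * q + 1 : ℕ) ^ n) - ((α i : ℕ) : ℝ) / 3) - (((α i : ℕ) * q : ℕ) : ℤ)) /
        ((3 * q + 1 : ℕ) : ℝ)⌋ := by
    intro z i
    unfold gridCell
    congr 1
    rw [pow_succ]
    field_simp
    push_cast
    ring
  ext i
  rw [key, key]
  exact Int.floor_sub_div_eq _ (congrFun h i)

theorem dist_le_of_gridCell_eq {d : ℕ} {b : ℝ} (hb : 0 < b) {μ : ℕ} (hμ : 0 < μ)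
    (α : Fin d → Fin 2) {n : ℕ} {x y : EuclideanSpace ℝ (Fin d)}
    (h : gridCell b μ α n x = gridCell b μ α n y) : dist x y ≤ d * (b * μ ^ n) := by
  have hB : 0 < b * (μ : ℝ) ^ n := by positivity
  have hi : ∀ i, dist (x i) (y i) ≤ b * μ ^ n := by
    intro i
    have h1 := Int.abs_sub_lt_one_of_floor_eq_floor (congrFun h i)
    rw [sub_sub_sub_cancel_right, ← sub_div, abs_div, abs_of_pos hB, div_lt_one hB] at h1
    exact h1.le
  rw [EuclideanSpace.dist_eq]
  refine Real.sqrt_le_iff.2 ⟨by positivity, ?_⟩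
  calc ∑ i, dist (x i) (y i) ^ 2 ≤ ∑ _i : Fin d, (b * (μ : ℝ) ^ n) ^ 2 :=
        Finset.sum_le_sum fun i _ => pow_le_pow_left₀ dist_nonneg (hi i) 2
    _ = d * (b * (μ : ℝ) ^ n) ^ 2 := by simp
    _ ≤ (d * (b * μ ^ n)) ^ 2 := by
      rw [mul_pow (d : ℝ)]
      gcongr
      exact_mod_cast Nat.le_self_pow two_ne_zero d

theorem exists_gridCell_eq {d : ℕ} {b : ℝ} (hb : 0 < b) {μ : ℕ} (hμ : 0 < μ) (n : ℕ)
    (x : EuclideanSpace ℝ (Fin d)) : ∃ α : Fin d → Fin 2, ∀ y, dist y x < b * μ ^ n / 6 →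
      gridCell b μ α n y = gridCell b μ α n x := by
  have hB : 0 < b * (μ : ℝ) ^ n := by positivity
  choose α hα using fun i : Fin d => exists_floor_sub_third_eq (x i / (b * μ ^ n))
  refine ⟨α, fun y hy => funext fun i => hα i _ ?_⟩
  rw [← sub_div, abs_div, abs_of_pos hB, div_lt_iff₀ hB]
  have h1 : |y i - x i| ≤ dist y x := by
    have := PiLp.norm_apply_le (y - x) i
    rwa [← dist_eq_norm] at this
  linarith

/-! ### Supported points of a packing -/

namespace SpherePacking

variable {V : Type*} {d : ℕ}

open scoped Classical in
/-- The points of the packing seen from `o` at scale `1 / δ`, outside the ball of scale `δ`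
around `p`. -/
noncomputable def annularSet [Fintype V] (P : SpherePacking V d) (δ : ℝ) (o : V)
    (p : EuclideanSpace ℝ (Fin d)) : Finset V :=
  Finset.univ.filter fun u => dist (P.center u) (P.center o) ≤ P.radius o / δ ∧
    δ * P.radius o < dist (P.center u) p

open scoped Classical in
/-- The points of the packing that see more than `s` other points at scale `1/δ`, outside any
ball of scale `δ`. -/
noncomputable def supportedPoints [Fintype V] (P : SpherePacking V d) (δ : ℝ) (s : ℕ) : Finset V :=
  Finset.univ.filter fun o => ∀ p, s ≤ (P.annularSet δ o p).card

/-- Disjoint balls of comparable radii centred in one cell of comparable size are boundedly many, by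
volume. So a supported cell accounts for boundedly many supported points. -/
theorem card_le_of_gridCell_eq (P : SpherePacking V d) {b : ℝ} (hb : 0 < b) {μ : ℕ} (hμ : 0 < μ)
    (α : Fin d → Fin 2) (k : ℕ) (S : Finset V) (a : Fin d → ℤ)
    (hS : ∀ o ∈ S, gridCell b μ α (k + 3) (P.center o) = a ∧ b * μ ^ (k + 1) ≤ P.radius o ∧
      P.radius o < b * μ ^ (k + 2)) : S.card ≤ ((d + 1) * μ ^ 2) ^ d := by
  rcases S.eq_empty_or_nonempty with rfl | ⟨o, ho⟩
  · simp
  have hμ' : (1 : ℝ) ≤ μ := by exact_mod_cast hμ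
  have h1 : ∑ u ∈ S, P.radius u ^ d ≤ ((d + 1) * (b * μ ^ (k + 3))) ^ d := by
    refine P.sum_radius_pow_le S (P.center o) (by positivity) fun u hu => ?_
    have h2 := dist_le_of_gridCell_eq hb hμ α ((hS u hu).1.trans (hS o ho).1.symm)
    have h3 : b * (μ : ℝ) ^ (k + 2) ≤ b * μ ^ (k + 3) := by gcongr; omega
    linarith [(hS u hu).2.2]
  have h2 : (S.card : ℝ) * (b * μ ^ (k + 1)) ^ d ≤ ∑ u ∈ S, P.radius u ^ d := by
    rw [← nsmul_eq_mul]
    exact Finset.card_nsmul_le_sum _ _ _ fun u hu =>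
      pow_le_pow_left₀ (by positivity) (hS u hu).2.1 _
  have h3 : ((d + 1) * (b * (μ : ℝ) ^ (k + 3))) ^ d =
      ((d + 1) * μ ^ 2) ^ d * (b * μ ^ (k + 1)) ^ d := by
    rw [← mul_pow]
    ring
  rw [h3] at h1
  have h4 := le_of_mul_le_mul_right (h2.trans h1) (by positivity)
  exact_mod_cast h4

/-- A supported point `o` is charged to a grid cell that contains the ball of radius `r_o / δ`
around its centre and whose children have diameter at most `δ r_o`. No child can capture all but
fewer than `s` of the points, so the cell is supported. -/
theorem card_supportedPoints_le (d : ℕ) {δ : ℝ} (hδ : 0 < δ) : ∃ C : ℕ, ∀ (V : Type*) [Fintype V]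
    (P : SpherePacking V d) (s : ℕ), s * (P.supportedPoints δ s).card ≤ C * Fintype.card V := by
  classical
  -- `d ≤ δ μ` makes the children small enough, and `6 < δ μ` makes the parent large enough for the
  -- `1 / 6` margin of the shifted grids.
  obtain ⟨q, hq⟩ := exists_nat_ge (max (d / δ) (6 / δ))
  obtain ⟨μ, hμdef⟩ : ∃ μ, μ = 3 * q + 1 := ⟨_, rfl⟩
  have hqμ : (q : ℝ) < μ := by
    have : q < μ := by omega
    exact_mod_cast this
  have hμ : 0 < μ := by omega
  have hμd : (d : ℝ) ≤ δ * μ := by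
    have := (le_max_left _ _).trans (hq.trans hqμ.le)
    rwa [div_le_iff₀' hδ] at this
  have hμ6 : (6 : ℝ) < δ * μ := by
    have := ((le_max_right _ _).trans hq).trans_lt hqμ
    rwa [div_lt_iff₀' hδ] at this
  have hμ1 : (1 : ℝ) < μ := by
    have h0 : (0 : ℝ) < q :=
      lt_of_lt_of_le (by positivity) ((le_max_right _ _).trans hq)
    have : 0 < q := by exact_mod_cast h0
    have : 1 < μ := by omega
    exact_mod_cast this
  let K := ((d + 1) * μ ^ 2) ^ d
  refine ⟨Fintype.card (Fin 3 × (Fin d → Fin 2)) * (K * 2), fun V _ P s => ?_⟩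
  obtain ⟨b, hb, hbr⟩ : ∃ b : ℝ, 0 < b ∧ ∀ v, b * μ ≤ P.radius v := by
    rcases isEmpty_or_nonempty V with hV | hV
    · exact ⟨1, one_pos, fun v => hV.elim v⟩
    · obtain ⟨v₀, hv₀⟩ := Finite.exists_min P.radius
      refine ⟨P.radius v₀ / μ, div_pos (P.radius_pos _) (by positivity), fun v => ?_⟩
      rw [div_mul_cancel₀ _ (by positivity)]
      exact hv₀ v
  have hk : ∀ o, ∃ k : ℕ, b * μ ^ (k + 1) ≤ P.radius o ∧ P.radius o < b * μ ^ (k + 2) := by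
    intro o
    obtain ⟨k, h1, h2⟩ := exists_nat_pow_near (x := P.radius o / (b * μ)) (y := (μ : ℝ))
      ((one_le_div (by positivity)).2 (hbr o)) hμ1
    rw [le_div_iff₀ (by positivity)] at h1
    rw [div_lt_iff₀ (by positivity)] at h2
    refine ⟨k, ?_, ?_⟩
    · rwa [mul_comm, mul_assoc, ← pow_succ'] at h1
    · rwa [mul_comm, mul_assoc, ← pow_succ'] at h2
  choose k hk1 hk2 using hk
  let L := (Finset.univ.sup k) + 1
  -- Parent and child are three grid levels apart (`k + 3` and `k`), so the levels are split by
  -- residue modulo `3`, separately for each of the `2 ^ d` shifts.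
  let c : Fin 3 × (Fin d → Fin 2) → ℕ → V → (Fin d → ℤ) := fun e n v =>
    gridCell b μ e.2 (3 * n + e.1) (P.center v)
  have hc : ∀ e n u v, c e n u = c e n v → c e (n + 1) u = c e (n + 1) v := by
    intro e n u v h
    have h' : gridCell b μ e.2 (3 * n + e.1) (P.center u) =
      gridCell b μ e.2 (3 * n + e.1) (P.center v) := h
    change gridCell b μ e.2 (3 * (n + 1) + e.1) (P.center u) =
      gridCell b μ e.2 (3 * (n + 1) + e.1) (P.center v)
    have h3 : 3 * (n + 1) + e.1 = 3 * n + e.1 + 1 + 1 + 1 := by ring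
    rw [h3]
    subst hμdef
    exact gridCell_succ_eq hb q _ (gridCell_succ_eq hb q _ (gridCell_succ_eq hb q _ h'))
  let F : Fin 3 × (Fin d → Fin 2) → ℕ → (Fin d → ℤ) → Finset V := fun e n a =>
    Finset.univ.filter fun o => c e (n + 1) o = a ∧ b * μ ^ (3 * n + e.1 + 1) ≤ P.radius o ∧
      P.radius o < b * μ ^ (3 * n + e.1 + 2)
  have hF : ∀ e n a, (F e n a).card ≤ K := by
    intro e n a
    refine P.card_le_of_gridCell_eq hb hμ e.2 (3 * n + e.1) _ a fun o ho => ?_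
    have := (Finset.mem_filter.1 ho).2
    refine ⟨?_, this.2⟩
    rw [← this.1]
    change _ = gridCell b μ e.2 (3 * (n + 1) + e.1) (P.center o)
    congr 1
    ring
  have hsub : P.supportedPoints δ s ⊆ Finset.univ.biUnion fun e =>
      (Finset.range L).biUnion fun n => (supportedCells (c e) s n).biUnion fun a => F e n a := by
    intro o ho
    have ho' : ∀ p, s ≤ (P.annularSet δ o p).card := (Finset.mem_filter.1 ho).2
    obtain ⟨α, hα⟩ := exists_gridCell_eq hb hμ (k o + 3) (P.center o)
    let e : Fin 3 × (Fin d → Fin 2) := (⟨k o % 3, Nat.mod_lt _ (by norm_num)⟩, α)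
    have hko : 3 * (k o / 3) + (e.1 : ℕ) = k o := Nat.div_add_mod _ _
    have hko' : 3 * (k o / 3 + 1) + (e.1 : ℕ) = k o + 3 := by omega
    simp only [Finset.mem_biUnion, Finset.mem_univ, true_and]
    refine ⟨e, k o / 3, ?_, c e (k o / 3 + 1) o, ?_, ?_⟩
    · have : k o ≤ Finset.univ.sup k := Finset.le_sup (Finset.mem_univ o)
      exact Finset.mem_range.2 (by omega)
    · refine Finset.mem_filter.2 ⟨Finset.mem_image_of_mem _ (Finset.mem_univ _), fun a => ?_⟩
      -- The child cell fits in the ball of radius `δ r_o` around any of its points; if it is empty,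
      -- any `p` does.
      obtain ⟨p, hp⟩ : ∃ p, ∀ u, c e (k o / 3) u = a →
          dist (P.center u) p ≤ d * (b * μ ^ (k o)) := by
        by_cases hex : ∃ u', c e (k o / 3) u' = a
        · obtain ⟨u', hu'⟩ := hex
          refine ⟨P.center u', fun u hu => ?_⟩
          have := hu.trans hu'.symm
          simp only [c, hko] at this
          exact dist_le_of_gridCell_eq hb hμ α this
        · exact ⟨0, fun u hu => (hex ⟨u, hu⟩).elim⟩
      refine (ho' p).trans (Finset.card_le_card fun u hu => ?_)
      obtain ⟨hu1, hu2⟩ := (Finset.mem_filter.1 hu).2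
      refine Finset.mem_filter.2 ⟨Finset.mem_univ _, ?_, fun hua => ?_⟩
      · simp only [c, hko']
        refine hα _ (hu1.trans_lt ?_)
        rw [div_lt_iff₀ hδ]
        calc P.radius o < b * μ ^ (k o + 2) := hk2 o
          _ = b * μ ^ (k o + 2) / 6 * 6 := by ring
          _ ≤ b * μ ^ (k o + 2) / 6 * (δ * μ) := by gcongr
          _ = b * μ ^ (k o + 3) / 6 * δ := by ring
      · refine absurd (hp u hua) (not_le.2 (lt_of_le_of_lt ?_ hu2))
        calc d * (b * (μ : ℝ) ^ (k o)) ≤ (δ * μ) * (b * μ ^ (k o)) := by gcongr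
          _ = δ * (b * μ ^ (k o + 1)) := by ring
          _ ≤ δ * P.radius o := by gcongr; exact hk1 o
    · refine Finset.mem_filter.2 ⟨Finset.mem_univ _, rfl, ?_⟩
      rw [hko]
      exact ⟨hk1 o, hk2 o⟩
  have hcard : (P.supportedPoints δ s).card ≤
      ∑ e, ∑ n ∈ Finset.range L, (supportedCells (c e) s n).card * K := by
    refine (Finset.card_le_card hsub).trans (Finset.card_biUnion_le.trans ?_)
    refine Finset.sum_le_sum fun e _ => Finset.card_biUnion_le.trans ?_
    exact Finset.sum_le_sum fun n _ => Finset.card_biUnion_le_card_mul _ _ _ fun a _ => hF e n a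
  calc s * (P.supportedPoints δ s).card
      ≤ s * ∑ e, ∑ n ∈ Finset.range L, (supportedCells (c e) s n).card * K := by gcongr
    _ = ∑ e, K * (s * ∑ n ∈ Finset.range L, (supportedCells (c e) s n).card) := by
      rw [Finset.mul_sum]
      refine Finset.sum_congr rfl fun e _ => ?_
      rw [← Finset.sum_mul]
      ring
    _ ≤ ∑ _e : Fin 3 × (Fin d → Fin 2), K * (2 * Fintype.card V) :=
      Finset.sum_le_sum fun e _ =>
        Nat.mul_le_mul_left _ (card_supportedCells_le (c e) (hc e) s L)
    _ = _ := by
      rw [Finset.sum_const, smul_eq_mul, Finset.card_univ]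
      ring

end SpherePacking

/-! ### Logarithmic potentials on packings. -/

theorem abs_clamp_sub_clamp_le (a b : ℝ) :
    |max 0 (min 1 a) - max 0 (min 1 b)| ≤ |a - b| :=
  (abs_max_sub_max_le_max _ _ _ _).trans (max_le (by simp)
    ((abs_min_sub_min_le_max _ _ _ _).trans (max_le (by simp) le_rfl)))

theorem SimpleGraph.normPow_le_ofReal {V : Type*} [Fintype V] {d : ℕ} {m : V → ℝ≥0} {B : ℝ}
    (h : ∑ u, (m u : ℝ) ^ d ≤ B) : SimpleGraph.normPow d m ≤ ENNReal.ofReal B := by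
  unfold SimpleGraph.normPow
  rw [tsum_fintype, ENNReal.le_ofReal_iff_toReal_le _ ((Finset.sum_nonneg fun u _ => by
    positivity).trans h)]
  · rw [ENNReal.toReal_sum (fun u _ => by finiteness)]
    simpa using h
  · exact (ENNReal.sum_lt_top.2 fun u _ => by finiteness).ne

theorem Finset.sum_pow_le_of_unique_ne_zero {ι : Type*} {S : Finset ι} {g : ι → ℝ} {d : ℕ}
    (hd : d ≠ 0) (hg : ∀ i ∈ S, 0 ≤ g i)
    (h : ∀ i ∈ S, ∀ j ∈ S, g i ≠ 0 → g j ≠ 0 → i = j) : (∑ i ∈ S, g i) ^ d ≤ ∑ i ∈ S, g i ^ d := by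
  by_cases hex : ∃ i ∈ S, g i ≠ 0
  · obtain ⟨i, hi, hgi⟩ := hex
    rw [Finset.sum_eq_single_of_mem i hi]
    · exact Finset.single_le_sum (f := fun i => g i ^ d) (fun j hj => pow_nonneg (hg j hj) d) hi
    · intro j hj hji
      by_contra hgj
      exact hji (h j hj i hi hgj hgi)
  · push Not at hex
    rw [Finset.sum_eq_zero hex, zero_pow hd]
    exact Finset.sum_nonneg fun j hj => pow_nonneg (hg j hj) d

namespace SpherePacking

variable {V : Type*} {d : ℕ}

/-- A logarithmic potential centred at the ball `w`, averaged over `N` separated scales. -/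
theorem exists_annular_potential [Fintype V] (P : SpherePacking V d) (hd : d ≠ 0) {M : ℝ}
    (hM : 0 ≤ M) (hP : P.IsUniform M) {N : ℕ} (hN : 0 < N) (w : V) {R : ℝ}
    (hR : (1 + M) * P.radius w ≤ R) :
    ∃ (φ : V → ℝ) (m : V → ℝ≥0),
      (∀ u, dist (P.center u) (P.center w) ≤ R → φ u = 0) ∧
      (∀ u, 2 * ((2 * (2 + M) ^ 2) ^ (N - 1) * R) ≤ dist (P.center u) (P.center w) → φ u = 1) ∧
      (∀ u v, P.tangencyGraph.Adj u v → |φ u - φ v| ≤ m u) ∧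
      ∑ u, (m u : ℝ) ^ d ≤ (4 * (2 + M) * (1 + M)) ^ d * N / N ^ d := by
  classical
  have hR0 : 0 < R := lt_of_lt_of_le (mul_pos (by linarith) (P.radius_pos w)) hR
  obtain ⟨K, hKdef⟩ : ∃ K, K = 2 + M := ⟨_, rfl⟩
  have hK : 2 ≤ K := by linarith
  obtain ⟨D, hD⟩ : ∃ D : V → ℝ, ∀ u, D u = dist (P.center u) (P.center w) := ⟨_, fun _ => rfl⟩
  -- An edge between balls other than `w` changes the distance to `w` by a factor at most `K`, so
  -- the gradient at scale `i` lives in `(ρ i / K, 2 K ρ i)`. The ratio `2 K ^ 2` is the least that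
  -- makes these annuli disjoint.
  obtain ⟨ρ, hρ⟩ : ∃ ρ : ℕ → ℝ, ∀ i, ρ i = (2 * K ^ 2) ^ i * R := ⟨_, fun _ => rfl⟩
  have hlam : (1 : ℝ) ≤ 2 * K ^ 2 := by nlinarith
  have hρ0 : ∀ i, 0 < ρ i := fun i => by rw [hρ]; positivity
  have hρmono : ∀ {i j}, i ≤ j → ρ i ≤ ρ j := fun {i j} hij => by
    rw [hρ, hρ]; gcongr
  have hρR : ∀ i, R ≤ ρ i := fun i => by
    simpa [hρ 0] using hρmono (Nat.zero_le i)
  have hDr : ∀ u, u ≠ w → P.radius u ≤ D u := fun u hu => by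
    have := P.radius_add_radius_le_dist hu
    rw [hD]; linarith [P.radius_pos w]
  have hadj : ∀ u v, P.tangencyGraph.Adj u v →
      dist (P.center u) (P.center v) ≤ (1 + M) * P.radius u := by
    rintro u v ⟨huv, ht⟩
    have h1 := hP v u huv.symm (SimpleGraph.Adj.symm (G := P.tangencyGraph) ⟨huv, ht⟩).2
    rw [div_le_iff₀ (P.radius_pos u)] at h1
    unfold Tangent at ht
    linarith
  have hDK : ∀ u v, P.tangencyGraph.Adj u v → u ≠ w → D v ≤ K * D u := by
    intro u v huv hu
    have h1 := hadj u v huv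
    have h2 := dist_triangle_left (P.center v) (P.center w) (P.center u)
    have h3 := hDr u hu
    rw [← hD, ← hD] at h2
    rw [hKdef]
    nlinarith
  let g : ℕ → V → ℝ := fun i u =>
    if ρ i / K < D u ∧ D u < 2 * ρ i * K then (1 + M) * P.radius u / ρ i else 0
  let h : ℕ → V → ℝ := fun i u => max 0 (min 1 ((D u - ρ i) / ρ i))
  have hg0 : ∀ i u, 0 ≤ g i u := fun i u => by
    simp only [g]
    split_ifs
    · have := P.radius_pos u
      have := hρ0 i
      positivity
    · exact le_rfl
  have hh0 : ∀ i u, D u ≤ ρ i → h i u = 0 := fun i u hu => by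
    refine max_eq_left ((min_le_right _ _).trans ?_)
    exact div_nonpos_of_nonpos_of_nonneg (by linarith) (hρ0 i).le
  have hh1 : ∀ i u, 2 * ρ i ≤ D u → h i u = 1 := fun i u hu => by
    have h1 : 1 ≤ (D u - ρ i) / ρ i := by
      rw [one_le_div (hρ0 i)]; linarith
    simp only [h]
    rw [min_eq_left h1]
    simp
  have hhg : ∀ i u v, P.tangencyGraph.Adj u v → |h i u - h i v| ≤ g i u := by
    intro i u v huv
    -- The factor `K` is not available at `w`, where `D` vanishes, but `R ≥ (1 + M) r_w` puts `w`
    -- and its neighbours where every `h i` is zero.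
    by_cases hu : u = w
    · subst hu
      have h1 : D v ≤ ρ i := by
        have := hadj u v huv
        rw [hD, dist_comm]
        linarith [hρR i]
      have h2 : D u ≤ ρ i := by
        rw [hD, dist_self]
        exact (hρ0 i).le
      rw [hh0 i u h2, hh0 i v h1, sub_zero, abs_zero]
      exact hg0 i u
    by_cases hv : v = w
    · subst hv
      have h1 : D u ≤ ρ i := by
        have := hadj v u huv.symm
        rw [hD, dist_comm]
        linarith [hρR i]
      have h2 : D v ≤ ρ i := by
        rw [hD, dist_self]
        exact (hρ0 i).le
      rw [hh0 i u h1, hh0 i v h2, sub_zero, abs_zero]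
      exact hg0 i u
    have hvu := hDK u v huv hu
    have huv' := hDK v u huv.symm hv
    have hρi := hρ0 i
    by_cases hcase : ρ i / K < D u ∧ D u < 2 * ρ i * K
    · simp only [g, if_pos hcase]
      refine (abs_clamp_sub_clamp_le _ _).trans ?_
      rw [← sub_div, abs_div, abs_of_pos (hρ0 i)]
      gcongr
      rw [sub_sub_sub_cancel_right, hD, hD]
      exact (abs_dist_sub_le _ _ _).trans (hadj u v huv)
    · have : h i u = h i v := by
        rw [not_and_or, not_lt, not_lt] at hcase
        rcases hcase with hc | hc
        · rw [le_div_iff₀ (by linarith)] at hc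
          have h1 : 0 ≤ D u := by rw [hD]; exact dist_nonneg
          rw [hh0 i u (by nlinarith), hh0 i v (by nlinarith)]
        · rw [hh1 i u (by nlinarith), hh1 i v (by nlinarith)]
      rw [this, sub_self, abs_zero]
      exact hg0 i u
  have hgd : ∀ i, ∑ u, g i u ^ d ≤ (4 * K * (1 + M)) ^ d := by
    intro i
    have hρi := hρ0 i
    have h1 : ∀ u, g i u ^ d = if ρ i / K < D u ∧ D u < 2 * ρ i * K then
        ((1 + M) / ρ i) ^ d * P.radius u ^ d else 0 := by
      intro u
      simp only [g]
      split_ifs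
      · rw [← mul_pow]; ring
      · exact zero_pow hd
    simp only [h1]
    rw [← Finset.sum_filter, ← Finset.mul_sum]
    have h2 := P.sum_radius_pow_le (Finset.univ.filter fun u => ρ i / K < D u ∧ D u < 2 * ρ i * K)
      (P.center w) (R := 4 * K * ρ i) (by positivity) (by
        intro u hu
        obtain ⟨hu1, hu2⟩ := (Finset.mem_filter.1 hu).2
        have huw : u ≠ w := by
          rintro rfl
          rw [hD, dist_self] at hu1
          exact absurd hu1 (not_lt.2 (by positivity))
        have := hDr u huw
        rw [← hD]
        linarith)
    calc _ ≤ ((1 + M) / ρ i) ^ d * (4 * K * ρ i) ^ d := by gcongr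
      _ = _ := by
        rw [← mul_pow]
        congr 1
        field_simp
  refine ⟨fun u => (∑ i ∈ Finset.range N, h i u) / N,
    fun u => Real.toNNReal ((∑ i ∈ Finset.range N, g i u) / N), ?_, ?_, ?_, ?_⟩
  · intro u hu
    rw [← hD] at hu
    simp only
    rw [Finset.sum_eq_zero fun i _ => hh0 i u (hu.trans (hρR i)), zero_div]
  · intro u hu
    rw [← hD, ← hKdef, ← hρ] at hu
    simp only
    rw [Finset.sum_congr rfl fun i hi => hh1 i u ?_]
    · simp [hN.ne']
    · have := hρmono (show i ≤ N - 1 by have := Finset.mem_range.1 hi; omega)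
      linarith
  · intro u v huv
    simp only
    rw [← sub_div, ← Finset.sum_sub_distrib, abs_div, abs_of_nonneg (Nat.cast_nonneg (α := ℝ) N)]
    refine le_trans ?_ (Real.le_coe_toNNReal _)
    gcongr
    exact (Finset.abs_sum_le_sum_abs _ _).trans (Finset.sum_le_sum fun i _ => hhg i u v huv)
  -- At each vertex at most one scale contributes, so energies add up over scales without cross
  -- terms.
  · have h1 : ∀ u, (Real.toNNReal ((∑ i ∈ Finset.range N, g i u) / N) : ℝ) ^ d ≤
        (∑ i ∈ Finset.range N, g i u ^ d) / N ^ d := by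
      intro u
      rw [Real.coe_toNNReal _ (div_nonneg (Finset.sum_nonneg fun i _ => hg0 i u)
        (Nat.cast_nonneg N)), div_pow]
      gcongr
      refine Finset.sum_pow_le_of_unique_ne_zero hd (fun i _ => hg0 i u) ?_
      have key : ∀ i j, g i u ≠ 0 → g j u ≠ 0 → ¬ i < j := by
        intro i j hi hj hij
        have hi' : ρ i / K < D u ∧ D u < 2 * ρ i * K := by
          by_contra hc
          exact hi (if_neg hc)
        have hj' : ρ j / K < D u ∧ D u < 2 * ρ j * K := by
          by_contra hc
          exact hj (if_neg hc)
        have h3 : ρ (i + 1) ≤ ρ j := hρmono hij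
        have h4 : ρ (i + 1) = 2 * K ^ 2 * ρ i := by rw [hρ, hρ]; ring
        have h5 := hj'.1.trans hi'.2
        rw [div_lt_iff₀ (by linarith)] at h5
        nlinarith
      intro i _ j _ hi hj
      exact le_antisymm (not_lt.1 (key j i hj hi)) (not_lt.1 (key i j hi hj))
    refine (Finset.sum_le_sum fun u _ => h1 u).trans ?_
    rw [← Finset.sum_div, Finset.sum_comm, ← hKdef]
    gcongr
    refine (Finset.sum_le_sum fun i _ => hgd i).trans ?_
    rw [Finset.sum_const, Finset.card_range, nsmul_eq_mul, mul_comm]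

/-- Either a small ball near `p` serves as centre of a second potential, or the balls centred near
`p` are so large that there is at most one besides `o`. The `2` in `s + 2` allows for that ball and
`o`. -/
theorem exists_hasSmallCapacity_of_card_annularSet_le (hd : 2 ≤ d) {M : ℝ} (hM : 0 ≤ M) {ε : ℝ}
    (hε : 0 < ε) : ∃ δ > 0, ∀ (V : Type*) [Fintype V] (P : SpherePacking V d), P.IsUniform M →
      ∀ (o : V) p (s : ℕ), (P.annularSet δ o p).card ≤ s →
      P.tangencyGraph.HasSmallCapacity o d (s + 2) (ENNReal.ofReal ε) := by
  classical
  obtain ⟨C, hC⟩ : ∃ C, C = (4 * (2 + M) * (1 + M)) ^ d := ⟨_, rfl⟩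
  have hC0 : 0 < C := by rw [hC]; positivity
  obtain ⟨N', hN'⟩ := exists_nat_ge (2 * C / ε)
  obtain ⟨N, hNdef⟩ : ∃ N, N = N' + 1 := ⟨_, rfl⟩
  have hN : 0 < N := by omega
  have hNr : (0 : ℝ) < N := by exact_mod_cast hN
  have henergy : 2 * (C * N / N ^ d) ≤ ε := by
    have h1 : (N : ℝ) * N ≤ N ^ d := by
      rw [← sq]
      exact pow_le_pow_right₀ (by exact_mod_cast hN) hd
    have h2 : 2 * C ≤ ε * N := by
      rw [div_le_iff₀' hε] at hN'
      have : (N' : ℝ) ≤ N := by exact_mod_cast (by omega : N' ≤ N)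
      nlinarith
    rw [← mul_div_assoc, div_le_iff₀ (by positivity)]
    nlinarith
  obtain ⟨L, hL⟩ : ∃ L, L = (2 * (2 + M) ^ 2) ^ (N - 1) := ⟨_, rfl⟩
  have hL1 : 0 < L := by rw [hL]; positivity
  -- `L` is the ratio of the extreme scales. With this `δ`, the potential at `o` reaches `1` before
  -- distance `r_o / δ`, and a ball around `w` of radius `r_o / (2 L)` covers the ball of radius `δ
  -- r_o` around `p`.
  refine ⟨1 / (4 * (1 + M) * L), by positivity, fun V _ P hP o p s hs => ?_⟩
  obtain ⟨δ, hδ⟩ : ∃ δ, δ = 1 / (4 * (1 + M) * L) := ⟨_, rfl⟩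
  rw [← hδ] at hs
  have hδ0 : 0 < δ := by rw [hδ]; positivity
  have hδ1 : δ * (4 * (1 + M) * L) = 1 := by
    rw [hδ]; exact one_div_mul_cancel (by positivity)
  have hro := P.radius_pos o
  obtain ⟨φ, m, hφ0, hφ1, hφm, hm⟩ :=
    P.exists_annular_potential (by omega) hM hP hN o le_rfl
  rw [← hL] at hφ1
  rw [← hC] at hm
  have hnear : ∀ u, φ u < 1 → dist (P.center u) (P.center o) ≤ P.radius o / δ := by
    intro u hu
    by_contra! hfar
    refine hu.ne (hφ1 u (le_trans ?_ hfar.le))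
    rw [le_div_iff₀ hδ0]
    calc 2 * (L * ((1 + M) * P.radius o)) * δ
        = (δ * (4 * (1 + M) * L)) * P.radius o / 2 := by ring
      _ ≤ P.radius o := by rw [hδ1]; linarith
  by_cases hcase : ∃ w, w ≠ o ∧ dist (P.center w) p ≤ δ * P.radius o ∧
      (1 + M) * P.radius w ≤ P.radius o / (2 * L)
  · obtain ⟨w, hwo, hwp, hwr⟩ := hcase
    obtain ⟨ψ, n, hψ0, hψ1, hψn, hn⟩ :=
      P.exists_annular_potential (by omega) hM hP hN w hwr
    rw [← hL] at hψ1
    rw [← hC] at hn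
    -- The potential `ψ` at `w` reaches `1` by distance `2 L * (r_o / (2 L)) = r_o`, and `o` is
    -- farther from `w` than that, so the maximum still vanishes at `o`.
    refine ⟨fun u => max (φ u) (1 - ψ u), fun u => max (m u) (n u), ?_, ?_, ?_, ?_⟩
    · have h1 : φ o = 0 := hφ0 o (by rw [dist_self]; positivity)
      have h2 : ψ o = 1 := by
        refine hψ1 o ?_
        have h3 := P.radius_add_radius_le_dist hwo.symm
        have h4 : 2 * (L * (P.radius o / (2 * L))) = P.radius o := by field_simp
        rw [h4]
        linarith [P.radius_pos w]
      simp [h1, h2]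
    · intro u v huv
      rw [NNReal.coe_max]
      refine (abs_max_sub_max_le_max _ _ _ _).trans (max_le_max (hφm u v huv) ?_)
      rw [sub_sub_sub_cancel_left, abs_sub_comm]
      exact hψn u v huv
    · refine le_trans (Set.encard_le_encard (t := ↑(P.annularSet δ o p)) fun u hu => ?_) ?_
      · have hu' : max (φ u) (1 - ψ u) < 1 := hu
        obtain ⟨hu1, hu2⟩ := max_lt_iff.1 hu'
        refine Finset.mem_coe.2 (Finset.mem_filter.2 ⟨Finset.mem_univ _, hnear u hu1, ?_⟩)
        have h1 : P.radius o / (2 * L) < dist (P.center u) (P.center w) := by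
          by_contra! h1
          rw [hψ0 u h1] at hu2
          linarith
        have h2 : 2 * (δ * P.radius o) ≤ P.radius o / (2 * L) := by
          rw [le_div_iff₀ (by positivity)]
          have h3 : δ * (4 * L) ≤ 1 := by
            rw [← hδ1]
            have : 0 ≤ δ * (4 * M * L) := by positivity
            linarith
          nlinarith
        have h3 := dist_triangle_right (P.center u) (P.center w) p
        linarith
      · rw [Set.encard_coe_eq_coe_finsetCard]
        exact_mod_cast hs.trans (by omega)
    · refine SimpleGraph.normPow_le_ofReal (le_trans ?_ henergy)
      calc ∑ u, ((max (m u) (n u) : ℝ≥0) : ℝ) ^ d ≤ ∑ u, ((m u : ℝ) ^ d + (n u : ℝ) ^ d) := by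
            refine Finset.sum_le_sum fun u _ => ?_
            rcases le_total (m u) (n u) with h | h
            · rw [max_eq_right h]
              exact le_add_of_nonneg_left (by positivity)
            · rw [max_eq_left h]
              exact le_add_of_nonneg_right (by positivity)
        _ ≤ _ := by
          rw [Finset.sum_add_distrib]
          linarith
  · push Not at hcase
    refine ⟨φ, m, hφ0 o (by rw [dist_self]; positivity), hφm, ?_, ?_⟩
    · let T : Finset V := (Finset.univ.filter fun u => dist (P.center u) p ≤ δ * P.radius o)
      have hT : (T.erase o).card ≤ 1 := by
        refine Finset.card_le_one.2 fun w hw w' hw' => ?_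
        by_contra hne
        obtain ⟨hwo, hwT⟩ := Finset.mem_erase.1 hw
        obtain ⟨hwo', hwT'⟩ := Finset.mem_erase.1 hw'
        have hwp := (Finset.mem_filter.1 hwT).2
        have hwp' := (Finset.mem_filter.1 hwT').2
        -- Two such balls would have centres more than `4 δ r_o` apart, yet both within `δ r_o` of
        -- `p`.
        have hlow : ∀ w, w ≠ o → dist (P.center w) p ≤ δ * P.radius o →
            2 * (δ * P.radius o) < P.radius w := by
          intro w hw1 hw2
          have h1 := hcase w hw1 hw2
          rw [div_lt_iff₀ (by positivity)] at h1
          refine lt_of_mul_lt_mul_right (a := 2 * (1 + M) * L) ?_ (by positivity)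
          calc 2 * (δ * P.radius o) * (2 * (1 + M) * L)
              = (δ * (4 * (1 + M) * L)) * P.radius o := by ring
            _ < _ := by rw [hδ1]; linarith
        have h1 := hlow w hwo hwp
        have h2 := P.radius_add_radius_le_dist hne
        have h3 := dist_triangle_right (P.center w) (P.center w') p
        linarith [P.radius_pos w']
      refine le_trans (Set.encard_le_encard
        (t := ↑(P.annularSet δ o p ∪ insert o (T.erase o))) fun u hu => ?_) ?_
      · rw [Finset.mem_coe, Finset.mem_union]
        by_cases hup : dist (P.center u) p ≤ δ * P.radius o
        · right
          by_cases huo : u = o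
          · exact Finset.mem_insert.2 (Or.inl huo)
          · exact Finset.mem_insert_of_mem (Finset.mem_erase.2
              ⟨huo, Finset.mem_filter.2 ⟨Finset.mem_univ _, hup⟩⟩)
        · left
          exact Finset.mem_filter.2 ⟨Finset.mem_univ _, hnear u hu, not_le.1 hup⟩
      · rw [Set.encard_coe_eq_coe_finsetCard]
        have h1 := Finset.card_union_le (P.annularSet δ o p) (insert o (T.erase o))
        have h2 := Finset.card_insert_le o (T.erase o)
        have h3 : (P.annularSet δ o p ∪ insert o (T.erase o)).card ≤ s + 2 := by omega
        exact_mod_cast h3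
    · refine SimpleGraph.normPow_le_ofReal (hm.trans (le_trans ?_ henergy))
      have : 0 ≤ C * N / (N : ℝ) ^ d := by positivity
      linarith

end SpherePacking

open scoped Classical in
/-- In a finite uniformly packable graph, most vertices have small capacity, uniformly over the
graph. -/
theorem SimpleGraph.IsUniformlyPackable.exists_card_not_hasSmallCapacity_le {d : ℕ} (hd : 2 ≤ d)
    {M : ℝ} (hM : 0 ≤ M) {ε : ℝ} (hε : 0 < ε) : ∃ C : ℕ, ∀ (V : Type*) [Fintype V]
      (G : SimpleGraph V), G.IsUniformlyPackable M d → ∀ s : ℕ,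
      s * (Finset.univ.filter fun o => ¬ G.HasSmallCapacity o d (s + 2) (ENNReal.ofReal ε)).card ≤
        C * Fintype.card V := by
  obtain ⟨δ, hδ, h1⟩ := SpherePacking.exists_hasSmallCapacity_of_card_annularSet_le hd hM hε
  obtain ⟨C, hC⟩ := SpherePacking.card_supportedPoints_le d hδ
  refine ⟨C, fun V _ G hG s => ?_⟩
  obtain ⟨P, hP, rfl⟩ := hG
  refine le_trans (Nat.mul_le_mul_left _ (Finset.card_le_card fun o ho => ?_)) (hC V P s)
  have ho' := (Finset.mem_filter.1 ho).2
  refine Finset.mem_filter.2 ⟨Finset.mem_univ _, fun p => ?_⟩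
  by_contra! hcon
  exact ho' (h1 V P hP o p s hcon.le)

/-! ### Balls and the local topology. -/

namespace RootedGraph

open SimpleGraph

theorem ball_iso_self (G : RootedGraph) {k : ℕ} (h : ∀ v, v ∈ G.ballSet k) : (G.ball k).Iso G :=
  ⟨⟨Equiv.subtypeUnivEquiv h, Iff.rfl⟩, rfl⟩

theorem hasSmallCapacity_ball (G : RootedGraph) {d s : ℕ} {ε : ℝ≥0∞}
    (h : G.graph.HasSmallCapacity G.root d s ε) (k : ℕ) :
    (G.ball k).graph.HasSmallCapacity (G.ball k).root d s ε :=
  h.comap (SimpleGraph.Embedding.induce (G.ballSet k)).toHom Subtype.val_injective rfl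

theorem exists_forall_mem_ballSet (G : RootedGraph) [Finite G.V] : ∃ k, ∀ v, v ∈ G.ballSet k := by
  obtain ⟨v₀, h⟩ := @Finite.exists_max _ _ _ ⟨G.root⟩ _ (fun v => G.graph.dist G.root v)
  exact ⟨_, h⟩

/-- A rooted graph whose ball of radius `k + 1` is isomorphic to that of a graph of radius `k` has
radius at most `k`. -/
theorem Iso.mem_ballSet {G H : RootedGraph} {k : ℕ} (h : ∀ v, v ∈ G.ballSet k)
    (hiso : (H.ball (k + 1)).Iso (G.ball (k + 1))) (v : H.V) : v ∈ H.ballSet k := by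
  obtain ⟨φ, hφ⟩ := hiso
  have hle : ∀ v ∈ H.ballSet (k + 1), v ∈ H.ballSet k := by
    intro v hv
    let v' : (H.ball (k + 1)).V := ⟨v, hv⟩
    have h1 := dist_iso φ.symm (G.ball (k + 1)).connected (G.ball (k + 1)).root (φ v')
    have h5 : φ.symm (φ v') = v' := φ.symm_apply_apply v'
    have h6 : φ.symm (G.ball (k + 1)).root = (H.ball (k + 1)).root := by
      rw [← hφ]
      exact φ.symm_apply_apply _
    rw [h5, h6] at h1
    have h2 := H.dist_ball (k + 1) v'
    have h3 := G.dist_ball (k + 1) (φ v')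
    have h4 := h (φ v').1
    calc H.graph.dist H.root v = _ := h2.symm
      _ ≤ _ := h1
      _ = _ := h3
      _ ≤ k := h4
  have hwalk : ∀ u v (_ : H.graph.Walk u v), v = H.root → u ∈ H.ballSet k := by
    intro u v w
    induction w with
    | nil => rintro rfl; exact H.root_mem_ballSet k
    | cons huv _ ih =>
      intro hv
      exact hle _ ((H.dist_root_le_of_adj huv.symm).trans (Nat.succ_le_succ (ih hv)))
  obtain ⟨w⟩ := H.connected.preconnected v H.root
  exact hwalk _ _ w rfl

end RootedGraph

namespace RootedGraphClass

theorem exists_rep (X : RootedGraphClass) : ∃ G, mk G = X := Quotient.exists_rep X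

theorem ball_eq_of_dist_lt {X Y : RootedGraphClass} {k : ℕ} (h : dist X Y < (1 + k : ℝ)⁻¹) :
    X.ball k = Y.ball k := by
  have h1 : (k : ℝ≥0∞) < agreement X Y := by
    by_contra! hle
    refine absurd h (not_lt.2 ?_)
    have h2 : (1 + k : ℝ≥0∞)⁻¹ ≤ (1 + agreement X Y)⁻¹ :=
      ENNReal.inv_le_inv.2 (add_le_add_right hle 1)
    have h3 := ENNReal.toReal_mono (inv_one_add_ne_top _) h2
    have h4 : ((1 + k : ℝ≥0∞)⁻¹).toReal = (1 + k : ℝ)⁻¹ := by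
      simp [ENNReal.toReal_inv, ENNReal.toReal_add]
    rwa [h4] at h3
  simp only [agreement, lt_iSup_iff] at h1
  obtain ⟨j, hj, hkj⟩ := h1
  have hkj' : k ≤ j := by exact_mod_cast hkj.le
  rw [← ball_ball _ hkj', hj, ball_ball _ hkj']

theorem isOpen_of_ball {S : Set RootedGraphClass} (k : ℕ)
    (h : ∀ X Y : RootedGraphClass, X.ball k = Y.ball k → X ∈ S → Y ∈ S) : IsOpen S := by
  refine Metric.isOpen_iff.2 fun X hX => ⟨(1 + k : ℝ)⁻¹, by positivity, fun Y hY => ?_⟩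
  exact h X Y (ball_eq_of_dist_lt (Metric.mem_ball'.1 hY)) hX

/-- If the graph has radius at most `k`, its ball of radius `k + 1` shows an empty sphere, so by
connectedness any graph sharing that ball is the same graph. -/
theorem isOpen_singleton_of_isFinite {X : RootedGraphClass} (hX : X.IsFinite) :
    IsOpen {X} := by
  obtain ⟨G, rfl⟩ := X.exists_rep
  have : Finite G.V := hX
  obtain ⟨k, hk⟩ := G.exists_forall_mem_ballSet
  refine isOpen_of_ball (k + 1) fun X Y hXY hX => ?_
  rw [Set.mem_singleton_iff] at hX ⊢
  subst hX
  obtain ⟨H, rfl⟩ := Y.exists_rep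
  have hiso : (H.ball (k + 1)).Iso (G.ball (k + 1)) := Quotient.exact hXY.symm
  have h1 : ∀ v, v ∈ H.ballSet (k + 1) := fun v =>
    Nat.le_succ_of_le (RootedGraph.Iso.mem_ballSet hk hiso v)
  have h2 : ∀ v, v ∈ G.ballSet (k + 1) := fun v => Nat.le_succ_of_le (hk v)
  exact Quotient.sound (((H.ball_iso_self h1).symm.trans hiso).trans (G.ball_iso_self h2))

theorem countable_isFinite : {X : RootedGraphClass | X.IsFinite}.Countable := by
  have : {X : RootedGraphClass | X.IsFinite} ⊆ ⋃ (n : ℕ) (g : SimpleGraph (Fin n)) (o : Fin n),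
      {X | ∃ hc : g.Connected, X = mk ⟨Fin n, g, o, hc, fun _ => Set.toFinite _⟩} := by
    intro X hX
    obtain ⟨G, rfl⟩ := X.exists_rep
    have : Finite G.V := hX
    obtain ⟨n, ⟨e⟩⟩ := Finite.exists_equiv_fin G.V
    let φ : G.graph ≃g G.graph.map e.toEmbedding := SimpleGraph.Iso.map e G.graph
    simp only [Set.mem_iUnion]
    exact ⟨n, G.graph.map e.toEmbedding, φ G.root, φ.connected_iff.1 G.connected,
      Quotient.sound ⟨φ, rfl⟩⟩
  refine Set.Countable.mono this ?_
  refine Set.countable_iUnion fun n => Set.countable_iUnion fun g => Set.countable_iUnion fun o =>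
    Set.Subsingleton.countable ?_
  rintro _ ⟨_, rfl⟩ _ ⟨_, rfl⟩
  rfl

/-! ### Unbiased laws and conditioning on the unrooted graph. -/

theorem mk_mem_withGraph (H : RootedGraph) : mk H ∈ withGraph H := ⟨H.root, rfl⟩

theorem exists_iso_of_mem_withGraph {H K : RootedGraph} (h : mk K ∈ withGraph H) :
    Nonempty (H.graph ≃g K.graph) := by
  obtain ⟨v, hv⟩ := h
  obtain ⟨φ, -⟩ := Quotient.exact hv
  exact ⟨φ⟩

theorem withGraph_subset_of_iso {H K : RootedGraph} (φ : H.graph ≃g K.graph) :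
    withGraph H ⊆ withGraph K := by
  rintro _ ⟨v, rfl⟩
  exact ⟨φ v, Quotient.sound ⟨φ.symm, φ.symm_apply_apply v⟩⟩

theorem withGraph_eq_of_iso {H K : RootedGraph} (φ : H.graph ≃g K.graph) :
    withGraph H = withGraph K :=
  (withGraph_subset_of_iso φ).antisymm (withGraph_subset_of_iso φ.symm)

theorem withGraph_eq_of_mem {H K : RootedGraph} {X : RootedGraphClass} (h : X ∈ withGraph H)
    (h' : X ∈ withGraph K) : withGraph H = withGraph K := by
  obtain ⟨G, rfl⟩ := X.exists_rep
  obtain ⟨φ⟩ := exists_iso_of_mem_withGraph h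
  obtain ⟨ψ⟩ := exists_iso_of_mem_withGraph h'
  exact withGraph_eq_of_iso (φ.trans ψ.symm)

theorem measurableSet_withGraph (H : RootedGraph) [Finite H.V] : MeasurableSet (withGraph H) := by
  rw [withGraph, ← Set.iUnion_singleton_eq_range]
  refine MeasurableSet.iUnion fun v => (isOpen_singleton_of_isFinite ?_).measurableSet
  exact ‹Finite H.V›

/-- Total probability: the sets `withGraph H` with `H` finite form a countable measurable partition
of almost all the space, and on each the conditional law is that of a uniform root. -/
theorem measure_le_of_isUnbiased {μ : Measure RootedGraphClass} [IsProbabilityMeasure μ]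
    (h : IsUnbiased μ) {A : Set RootedGraphClass} {η : ℝ≥0∞}
    (hη : ∀ (H : RootedGraph) [Finite H.V], μ (withGraph H) ≠ 0 → uniformRootLaw H A ≤ η) :
    μ A ≤ η := by
  let 𝒲 : Set (Set RootedGraphClass) := {W | ∃ H : RootedGraph, Finite H.V ∧ W = withGraph H}
  have hcount : 𝒲.Countable := by
    refine (countable_isFinite.image fun X => withGraph (Quotient.out X)).mono ?_
    rintro _ ⟨H, hH, rfl⟩
    refine ⟨mk H, hH, withGraph_eq_of_mem (X := mk H) ?_ (mk_mem_withGraph H)⟩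
    have h1 : mk (Quotient.out (mk H)) = mk H := Quotient.out_eq (mk H)
    have h2 := mk_mem_withGraph (Quotient.out (mk H))
    rwa [h1] at h2
  have hdisj : 𝒲.PairwiseDisjoint id := by
    rintro _ ⟨H, _, rfl⟩ _ ⟨K, _, rfl⟩ hne
    refine Set.disjoint_left.2 fun X hX hX' => hne (withGraph_eq_of_mem hX hX')
  have hmeas : ∀ W ∈ 𝒲, MeasurableSet W := by
    rintro _ ⟨H, _, rfl⟩
    exact measurableSet_withGraph H
  have hle : ∀ W ∈ 𝒲, μ (A ∩ W) ≤ η * μ W := by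
    rintro _ ⟨H, _, rfl⟩
    by_cases h0 : μ (withGraph H) = 0
    · exact (measure_mono_null Set.inter_subset_right h0).le.trans zero_le
    · have h1 := hη H h0
      rw [← h.2 H h0, ProbabilityTheory.cond_apply (measurableSet_withGraph H), mul_comm,
        ← div_eq_mul_inv, ENNReal.div_le_iff h0 (measure_ne_top _ _), Set.inter_comm] at h1
      exact h1
  have hcountable : Countable 𝒲 := hcount.to_subtype
  calc μ A ≤ μ (⋃ W : 𝒲, A ∩ W) := by
        refine measure_mono_ae ?_
        filter_upwards [h.1] with X hX hXA
        obtain ⟨G, rfl⟩ := X.exists_rep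
        exact Set.mem_iUnion.2 ⟨⟨withGraph G, G, hX, rfl⟩, hXA, mk_mem_withGraph G⟩
    _ ≤ ∑' W : 𝒲, μ (A ∩ W) := measure_iUnion_le _
    _ ≤ ∑' W : 𝒲, η * μ W := ENNReal.tsum_le_tsum fun W => hle W W.2
    _ = η * μ (⋃₀ 𝒲) := by rw [ENNReal.tsum_mul_left, measure_sUnion hcount hdisj hmeas]
    _ ≤ η * 1 := by gcongr; exact prob_le_one
    _ = η := mul_one _

theorem uniformRootLaw_le (H : RootedGraph) [Finite H.V] {A : Set RootedGraphClass}
    (hA : MeasurableSet A) (B : Finset H.V) (hB : ∀ v, mk (H.reroot v) ∈ A → v ∈ B) {C s : ℕ}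
    (hs : s ≠ 0) (h : s * B.card ≤ C * Nat.card H.V) :
    uniformRootLaw H A ≤ C / s := by
  classical
  let _ : Fintype H.V := Fintype.ofFinite H.V
  have : Nonempty H.V := ⟨H.root⟩
  rw [Nat.card_eq_fintype_card] at h
  unfold uniformRootLaw
  rw [PMF.toMeasure_apply_eq_toOuterMeasure_apply _ hA, PMF.toOuterMeasure_map_apply]
  refine (measure_mono (t := (B : Set H.V)) fun v hv => hB v hv).trans ?_
  rw [PMF.toOuterMeasure_uniformOfFintype_apply]
  rw [ENNReal.div_le_iff (by simp) (by simp), ← ENNReal.mul_div_right_comm,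
    ENNReal.le_div_iff_mul_le (by simp [hs]) (by simp)]
  have : B.card * s ≤ C * Fintype.card H.V := by rwa [mul_comm]
  simp
  convert (by exact_mod_cast this : (B.card : ℝ≥0∞) * s ≤ C * Fintype.card H.V)

/-! ### Capacity events and passage to the limit. -/

/-- The capacity condition on isomorphism classes. -/
def HasSmallCapacity (X : RootedGraphClass) (d s : ℕ) (ε : ℝ≥0∞) : Prop :=
  ∃ G, mk G = X ∧ G.graph.HasSmallCapacity G.root d s ε

theorem hasSmallCapacity_mk_iff {G : RootedGraph} {d s : ℕ} {ε : ℝ≥0∞} :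
    (mk G).HasSmallCapacity d s ε ↔ G.graph.HasSmallCapacity G.root d s ε := by
  refine ⟨?_, fun h => ⟨G, rfl, h⟩⟩
  rintro ⟨H, hH, h⟩
  obtain ⟨φ, hφ⟩ := Quotient.exact hH.symm
  exact h.comap φ.toHom φ.injective hφ

theorem isClopen_setOf_not_hasSmallCapacity_ball (d s k : ℕ) (ε : ℝ≥0∞) :
    IsClopen {X : RootedGraphClass | ¬ (X.ball k).HasSmallCapacity d s ε} := by
  refine ⟨⟨isOpen_of_ball k fun X Y hXY hX hY => hX ?_⟩,
    isOpen_of_ball k fun X Y hXY hX hY => hX ?_⟩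
  · intro hX'
    exact hY (hXY ▸ hX')
  · exact hXY ▸ hY

theorem exists_measure_not_hasSmallCapacity_le {d : ℕ} (hd : 2 ≤ d) {M : ℝ} (hM : 0 ≤ M) {ε : ℝ}
    (hε : 0 < ε) : ∃ C : ℕ, ∀ (μ : Measure RootedGraphClass) [IsProbabilityMeasure μ],
      IsUnbiased μ → (∀ H : RootedGraph, Finite H.V → μ (withGraph H) ≠ 0 →
        H.graph.IsUniformlyPackable M d) → ∀ s k : ℕ, s ≠ 0 →
      μ {X | ¬ (X.ball k).HasSmallCapacity d (s + 2) (ENNReal.ofReal ε)} ≤ C / s := by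
  classical
  obtain ⟨C, hC⟩ :=
    SimpleGraph.IsUniformlyPackable.exists_card_not_hasSmallCapacity_le.{0} hd hM hε
  refine ⟨C, fun μ _ hμ hpack s k hs => measure_le_of_isUnbiased hμ fun H _ hH => ?_⟩
  have := Fintype.ofFinite H.V
  refine uniformRootLaw_le H (isClopen_setOf_not_hasSmallCapacity_ball _ _ _ _).isOpen.measurableSet _
    (fun v hv => ?_) hs (by
      rw [Nat.card_eq_fintype_card]
      exact hC H.V H.graph (hpack H inferInstance hH) s)
  refine Finset.mem_filter.2 ⟨Finset.mem_univ _, fun hcap => hv ?_⟩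
  exact hasSmallCapacity_mk_iff.2 ((H.reroot v).hasSmallCapacity_ball hcap k)

end RootedGraphClass

/-- Local limits of unbiased random rooted graphs that are `M`-uniformly sphere-packable in `ℝ^d`
are almost surely `d`-parabolic. -/
theorem theorem1 (M : ℝ) (hM : 0 ≤ M) (d : ℕ) (hd : 2 ≤ d)
    {Ω : ℕ → Type*} [∀ n, MeasurableSpace (Ω n)]
    (P : ∀ n, Measure (Ω n)) [∀ n, IsProbabilityMeasure (P n)]
    {Ω' : Type*} [MeasurableSpace Ω'] (P' : Measure Ω') [IsProbabilityMeasure P']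
    (X : ∀ n, Ω n → RootedGraphClass) (Y : Ω' → RootedGraphClass)
    (hunbiased : ∀ n, RootedGraphClass.IsUnbiased ((P n).map (X n)))
    (hpack : ∀ n, ∀ᵐ ω ∂(P n), (X n ω).IsUniformlyPackable M d)
    (hlim : TendstoInDistribution X atTop Y P P') :
    ∀ᵐ ω ∂P', (Y ω).IsParabolic d := by
  have hX := hlim.forall_aemeasurable
  have hY := hlim.aemeasurable_limit
  have hprob : ∀ n, IsProbabilityMeasure ((P n).map (X n)) := fun n =>
    Measure.isProbabilityMeasure_map (hX n)
  have hpack' : ∀ n, ∀ H : RootedGraph, Finite H.V →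
      (P n).map (X n) (RootedGraphClass.withGraph H) ≠ 0 → H.graph.IsUniformlyPackable M d := by
    intro n H _ hH
    rw [Measure.map_apply_of_aemeasurable (hX n)
      (RootedGraphClass.measurableSet_withGraph H)] at hH
    obtain ⟨ω, hω, hp⟩ := ((frequently_ae_mem_iff.2 hH).and_eventually (hpack n)).exists
    obtain ⟨v, hv⟩ : X n ω ∈ RootedGraphClass.withGraph H := hω
    rw [← hv] at hp
    exact hp
  have hcap : ∀ n j : ℕ, ∀ᵐ ω ∂P', ∃ s,
      ((Y ω).ball (s + j)).HasSmallCapacity d s (n + 1 : ℝ≥0∞)⁻¹ := by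
    intro n j
    obtain ⟨C, hC⟩ := RootedGraphClass.exists_measure_not_hasSmallCapacity_le hd hM
      (ε := (n + 1 : ℝ)⁻¹) (by positivity)
    have hε : ENNReal.ofReal (n + 1 : ℝ)⁻¹ = (n + 1 : ℝ≥0∞)⁻¹ := by
      rw [ENNReal.ofReal_inv_of_pos (by positivity), ENNReal.ofReal_add (by positivity) (by simp)]
      simp
    rw [hε] at hC
    -- Portmanteau for open sets; the constant `C` depends neither on `s` nor on the radius, which
    -- may therefore grow with `s`.
    have hlimit : ∀ s : ℕ, s ≠ 0 → P' {ω | ¬ ((Y ω).ball (s + 2 + j)).HasSmallCapacity d (s + 2)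
        (n + 1 : ℝ≥0∞)⁻¹} ≤ C / s := by
      intro s hs
      have hclopen := RootedGraphClass.isClopen_setOf_not_hasSmallCapacity_ball d (s + 2)
        (s + 2 + j) (n + 1 : ℝ≥0∞)⁻¹
      have h1 := ProbabilityMeasure.le_liminf_measure_open_of_tendsto hlim.tendsto
        hclopen.isOpen
      simp only [ProbabilityMeasure.coe_mk] at h1
      rw [Measure.map_apply_of_aemeasurable hY hclopen.isOpen.measurableSet] at h1
      refine h1.trans ?_
      refine (liminf_le_liminf (Eventually.of_forall fun i =>
        hC ((P i).map (X i)) (hunbiased i) (hpack' i) s (s + 2 + j) hs)).trans ?_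
      rw [liminf_const]
    have hzero : P' {ω | ∀ s, ¬ ((Y ω).ball (s + j)).HasSmallCapacity d s
        (n + 1 : ℝ≥0∞)⁻¹} ≤ 0 := by
      have hC0 : Tendsto (fun s : ℕ => (C : ℝ≥0∞) / s) atTop (𝓝 0) := by
        have := ENNReal.Tendsto.const_div ENNReal.tendsto_nat_nhds_top
          (Or.inr (ENNReal.natCast_ne_top C))
        rwa [ENNReal.div_top] at this
      refine ge_of_tendsto hC0 ?_
      filter_upwards [eventually_ne_atTop 0] with s hs
      refine le_trans (measure_mono ?_) (hlimit s hs)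
      intro ω hω
      exact hω (s + 2)
    rw [ae_iff]
    simpa using hzero
  have hall : ∀ᵐ ω ∂P', ∀ n j : ℕ, ∃ s,
      ((Y ω).ball (s + j)).HasSmallCapacity d s (n + 1 : ℝ≥0∞)⁻¹ :=
    ae_all_iff.2 fun n => ae_all_iff.2 fun j => hcap n j
  filter_upwards [hall] with ω hω
  obtain ⟨G, hG⟩ := (Y ω).exists_rep
  rw [← hG] at hω ⊢
  exact G.isParabolic_of_hasSmallCapacity (by omega) fun n j =>
      (hω n j).imp fun s hs => RootedGraphClass.hasSmallCapacity_mk_iff.1 hs
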